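/- Let $X,Y,Z,D,d\in\mathbb N$ with $Z\ge 1$, $D\ge 1$. For each $x\in[X]$ let $\rho_x$ be a $D$-dimensional quantum state (a positive semidefinite matrix in $\mathbb C^{D\times D}$ with $\mathrm{tr}\,\rho_x=1$), and for each $y\in[Y]$ let $(E_{yz})_{z=1}^Z$ be a $D$-dimensional POVM (positive semidefinite matrices in $\mathbb C^{D\times D}$ with $\sum_{z=1}^Z E_{yz}=I$). Put $J=X+YZ$, let $\varepsilon\in(0,1/2]$, and suppose that $$d>\frac{32}{\varepsilon^2}\ln(4JD)\qquad\text{and}\qquad d>\frac{32}{\varepsilon^2}\,\mathrm{rank}\Bigl(\sum_{z=1}^{Z-1}E_{yz}\Bigr)\ \text{ for every } y\in[Y].$$ Then there exist $d$-dimensional quantum states $\rho'_x$ and $d$-dimensional POVMs $(E'_{yz})_{z=1}^Z$ such that for all $x\in[X]$, $y\in[Y]$, $$\bigl|\mathrm{tr}(\rho'_xE'_{yz})-\mathrm{tr}(\rho_xE_{yz})\bigr|\le 200\,\varepsilon\,\mathrm{tr}(E_{yz})\quad\text{for } z\in[Z-1],$$ $$\bigl|\mathrm{tr}(\rho'_xE'_{yZ})-\mathrm{tr}(\rho_xE_{yZ})\bigr|\le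 200\,\varepsilon\,\mathrm{tr}(I-E_{yZ}).$$ Moreover, such $(\rho'_x)_x$, $(E'_{yz})_{yz}$ can be computed in randomized polynomial time: there are a single program for a real random access machine (exact unit-cost arithmetic and comparison of real numbers, addition, subtraction and comparison of natural-number indices, indirect addressing, and an instruction that draws an independent standard Gaussian) and constants $C,k\in\mathbb N$ such that on every input $(X,Y,Z,D,d,\varepsilon,(\rho_x)_x,(E_{yz})_{yz})$ as above the program always halts within $C\,(X+Y+Z+\max(D,d))^k$ steps, and with probability at least $2/3$ its output is a family of $d$-dimensional states and POVMs with the above properties. (When $d\le D$, the case of compression, the bound is a polynomial in $X,Y,Z,D$.) -/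

import Mathlib

open scoped ComplexOrder

/-! ### Quantum models -/

/-- A `D`-dimensional quantum state: a positive semidefinite matrix of trace one. -/
def IsState {D : ℕ} (ρ : Matrix (Fin D) (Fin D) ℂ) : Prop :=
  ρ.PosSemidef ∧ ρ.trace = 1

/-- A `D`-dimensional POVM with `Z` outcomes. -/
def IsPOVM {D Z : ℕ} (E : Fin Z → Matrix (Fin D) (Fin D) ℂ) : Prop :=
  (∀ z, (E z).PosSemidef) ∧ ∑ z, E z = 1

/-- A `D`-dimensional quantum model: states `ρ x` and, for each `y`, a POVM `E y`. -/
def IsQuantumModel {X Y Z D : ℕ} (ρ : Fin X → Matrix (Fin D) (Fin D) ℂ)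
    (E : Fin Y → Fin Z → Matrix (Fin D) (Fin D) ℂ) : Prop :=
  (∀ x, IsState (ρ x)) ∧ ∀ y, IsPOVM (E y)

/-- The sum of all POVM elements except the last one. -/
def sumButLast {Z D : ℕ} (E : Fin Z → Matrix (Fin D) (Fin D) ℂ) : Matrix (Fin D) (Fin D) ℂ :=
  ∑ z ∈ Finset.univ.filter (fun z : Fin Z => (z : ℕ) + 1 < Z), E z

/-- The approximation guarantee. The outcomes are numbered `0, …, Z - 1`; the last one is special.
All the traces below are traces of (products of two) Hermitian matrices, hence real numbers. -/
def Approximates {X Y Z D d : ℕ} (ε : ℝ) (ρ : Fin X → Matrix (Fin D) (Fin D) ℂ)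
    (E : Fin Y → Fin Z → Matrix (Fin D) (Fin D) ℂ) (ρ' : Fin X → Matrix (Fin d) (Fin d) ℂ)
    (E' : Fin Y → Fin Z → Matrix (Fin d) (Fin d) ℂ) : Prop :=
  ∀ (x : Fin X) (y : Fin Y) (z : Fin Z),
    ((z : ℕ) + 1 < Z →
      ‖(ρ' x * E' y z).trace - (ρ x * E y z).trace‖ ≤ 200 * ε * (E y z).trace.re) ∧
    ((z : ℕ) + 1 = Z →
      ‖(ρ' x * E' y z).trace - (ρ x * E y z).trace‖ ≤ 200 * ε * (1 - E y z).trace.re)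

/-! ### Randomized real random access machines

Programs have finitely many index registers (natural numbers, with addition, subtraction and
comparison only), an unbounded real memory addressed through the index registers, exact unit-cost
real arithmetic and comparison, and an instruction that draws a fresh standard Gaussian. -/

namespace RealRAM

/-- `idx i` is index register `i`, `mem a` is the real memory cell with address `a`,
`pos` is the number of random samples drawn so far. -/
structure State where
  idx : ℕ → ℕ
  mem : ℕ → ℝ
  pos : ℕ

/-- Elementary instructions. The arguments are numbers of index registers, except for the
constant `c`. Real operands are addressed indirectly: operand `i` is the cell `mem (idx i)`. -/
inductive Instr where
  | idxConst (i c : ℕ)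
  | idxAdd (i j k : ℕ)
  | idxSub (i j k : ℕ)
  | cast (i j : ℕ)
  | add (i j k : ℕ)
  | sub (i j k : ℕ)
  | mul (i j k : ℕ)
  | div (i j k : ℕ)
  | sample (i : ℕ)

/-- Write `n` into index register `i`. -/
def State.setIdx (s : State) (i n : ℕ) : State :=
  { s with idx := Function.update s.idx i n }

/-- Write `r` into the real cell addressed by index register `i`. -/
def State.setMem (s : State) (i : ℕ) (r : ℝ) : State :=
  { s with mem := Function.update s.mem (s.idx i) r }

/-- The real cell addressed by index register `i`. -/
def State.get (s : State) (i : ℕ) : ℝ := s.mem (s.idx i)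

/-- The effect of an instruction, `ω 0, ω 1, …` being the random samples. Subtraction of indices is
truncated at `0`, and a division by `0` returns `0`. -/
noncomputable def Instr.apply (ω : ℕ → ℝ) (s : State) : Instr → State
  | .idxConst i c => s.setIdx i c
  | .idxAdd i j k => s.setIdx i (s.idx j + s.idx k)
  | .idxSub i j k => s.setIdx i (s.idx j - s.idx k)
  | .cast i j => s.setMem i (s.idx j : ℝ)
  | .add i j k => s.setMem i (s.get j + s.get k)
  | .sub i j k => s.setMem i (s.get j - s.get k)
  | .mul i j k => s.setMem i (s.get j * s.get k)
  | .div i j k => s.setMem i (s.get j / s.get k)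
  | .sample i => { s.setMem i (ω s.pos) with pos := s.pos + 1 }

/-- Elementary tests: compare two index registers or two real cells. -/
inductive Test where
  | idxLt (i j : ℕ)
  | realLt (i j : ℕ)

/-- The truth value of a test. -/
def Test.holds (s : State) : Test → Prop
  | .idxLt i j => s.idx i < s.idx j
  | .realLt i j => s.get i < s.get j

/-- Programs: instructions, composition, branching, and while loops. -/
inductive Program where
  | instr (i : Instr)
  | seq (p q : Program)
  | cond (b : Test) (p q : Program)
  | loop (b : Test) (p : Program)

/-- `Exec ω p s t s'`: started in `s` with random samples `ω`, the program `p` halts in `s'` after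
exactly `t` steps. Each instruction and each evaluation of a test is one step. -/
inductive Exec (ω : ℕ → ℝ) : Program → State → ℕ → State → Prop where
  | instr (i : Instr) (s : State) : Exec ω (.instr i) s 1 (i.apply ω s)
  | seq {p q : Program} {s s' s'' : State} {m n : ℕ} :
      Exec ω p s m s' → Exec ω q s' n s'' → Exec ω (.seq p q) s (m + n) s''
  | condTrue {b : Test} {p q : Program} {s s' : State} {n : ℕ} :
      b.holds s → Exec ω p s n s' → Exec ω (.cond b p q) s (n + 1) s'
  | condFalse {b : Test} {p q : Program} {s s' : State} {n : ℕ} :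
      ¬ b.holds s → Exec ω q s n s' → Exec ω (.cond b p q) s (n + 1) s'
  | loopTrue {b : Test} {p : Program} {s s' s'' : State} {m n : ℕ} :
      b.holds s → Exec ω p s m s' → Exec ω (.loop b p) s' n s'' →
        Exec ω (.loop b p) s (m + n + 1) s''
  | loopFalse {b : Test} {p : Program} {s : State} :
      ¬ b.holds s → Exec ω (.loop b p) s 1 s

/-- The law of the random samples: independent standard Gaussians. -/
noncomputable def gaussians : MeasureTheory.Measure (ℕ → ℝ) :=
  MeasureTheory.Measure.infinitePi (fun _ : ℕ => ProbabilityTheory.gaussianReal 0 1)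

/-- The `n`-th block of the memory region starting at `base` holds the complex `k × k` matrix `M`,
row by row, real part followed by imaginary part. -/
def HoldsMatrix (mem : ℕ → ℝ) (base n : ℕ) {k : ℕ} (M : Matrix (Fin k) (Fin k) ℂ) : Prop :=
  ∀ a b : Fin k,
    mem (base + 2 * ((n * k + a) * k + b)) = (M a b).re ∧
    mem (base + 2 * ((n * k + a) * k + b) + 1) = (M a b).im

/-- The memory region starting at `base` holds the matrices `ρ x` followed by the `E y z`. -/
def HoldsModel (mem : ℕ → ℝ) (base : ℕ) {X Y Z k : ℕ} (ρ : Fin X → Matrix (Fin k) (Fin k) ℂ)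
    (E : Fin Y → Fin Z → Matrix (Fin k) (Fin k) ℂ) : Prop :=
  (∀ x : Fin X, HoldsMatrix mem base x (ρ x)) ∧
  ∀ (y : Fin Y) (z : Fin Z), HoldsMatrix mem base (X + (y * Z + z)) (E y z)

/-- The initial state presents the input: the sizes `X, Y, Z, D, d` in the first five index
registers, `ε` in cell `0`, and the model from cell `1` on. -/
def IsInput (s : State) {X Y Z D : ℕ} (d : ℕ) (ε : ℝ) (ρ : Fin X → Matrix (Fin D) (Fin D) ℂ)
    (E : Fin Y → Fin Z → Matrix (Fin D) (Fin D) ℂ) : Prop :=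
  s.idx 0 = X ∧ s.idx 1 = Y ∧ s.idx 2 = Z ∧ s.idx 3 = D ∧ s.idx 4 = d ∧
  s.mem 0 = ε ∧ HoldsModel s.mem 1 ρ E ∧ s.pos = 0

/-- The final state presents the output: it is stored from the address in index register `0` on. -/
def IsOutput (s : State) {X Y Z d : ℕ} (ρ' : Fin X → Matrix (Fin d) (Fin d) ℂ)
    (E' : Fin Y → Fin Z → Matrix (Fin d) (Fin d) ℂ) : Prop :=
  HoldsModel s.mem (s.idx 0) ρ' E'

end RealRAM

/-! The compression is a Johnson–Lindenstrauss map. Take a real `d × D` matrix `G` of independent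
standard Gaussians, replace each state by `G ρ Gᴴ` divided by its trace, replace each effect but the
last by `G E Gᴴ / (d (1 + 8 ε))`, and let the last effect complete the sum to one.

Approximation: spectral decomposition turns `tr (ρ E)` into `∑ p_i q_j |⟨ψ_i, φ_j⟩|²` with unit
vectors and nonnegative weights of total `tr E`. If `G / √d` preserves the squared norms of all
`ψ_i` and `ψ_i + I^k φ_j` up to a relative error `ε`, polarization controls each inner product, and
the error is `O(ε) tr E` (`sketch_approximates`). The error of the last outcome is minus the sum of
the other errors.

Positivity of the last effect: if `S` is the sum of the other effects, then `G S Gᴴ ≤ d (1 + 8 ε)`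
is needed. As `0 ≤ S ≤ 1`, it is enough that `G / √d` expands squared norms on the range of `S` by
at most `1 + 8 ε` (`posSemidef_one_sub_sketchEffect`). A net of at most `625 ^ rank S` points
reduces this to finitely many vectors (`exists_net_almost_isometry`).

Probability: for a fixed vector the chi-square tail is `4 exp (-d δ² / 8)`. In the union bound the
logarithmic hypothesis pays for the vectors of the decompositions and the rank hypothesis pays for
the nets, so failure has probability at most `1 / 3` (`gaussianMatrix_goodSketch`).

Computation: the compressed model is a rational function of the input and `G`; square roots and
eigenvectors occur only in the analysis. A small language with bounded loops therefore suffices. It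
is compiled to the machine, and its cost is polynomial by structural induction. The program outputs
the compressed model for every random tape (`sketchProgram_spec`); chance only decides whether that
model is good. -/

namespace RealRAM

/-! ### Executions with a time bound -/

/-- `Runs ω P s T s'`: started in `s`, the program `P` halts in `s'` after at most `T` steps. -/
def Runs (ω : ℕ → ℝ) (P : Program) (s : State) (T : ℕ) (s' : State) : Prop :=
  ∃ t ≤ T, Exec ω P s t s'

variable {ω : ℕ → ℝ}

theorem Runs.mono {P : Program} {s s' : State} {T T' : ℕ} (h : Runs ω P s T s') (hT : T ≤ T') :
    Runs ω P s T' s' := by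
  obtain ⟨t, ht, h⟩ := h
  exact ⟨t, ht.trans hT, h⟩

theorem Runs.instr (i : Instr) (s : State) : Runs ω (.instr i) s 1 (i.apply ω s) :=
  ⟨1, le_rfl, .instr i s⟩

theorem Runs.seq {P Q : Program} {s s' s'' : State} {T T' : ℕ} (h : Runs ω P s T s')
    (h' : Runs ω Q s' T' s'') : Runs ω (.seq P Q) s (T + T') s'' := by
  obtain ⟨t, ht, h⟩ := h
  obtain ⟨t', ht', h'⟩ := h'
  exact ⟨t + t', by omega, .seq h h'⟩

/-- A counting loop with an invariant. -/
theorem Runs.loop_counter {P : Program} {i b n : ℕ} {T : ℕ → ℕ} (I : ℕ → State → Prop)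
    (hidx : ∀ k s, I k s → s.idx i = k ∧ s.idx b = n)
    (hstep : ∀ k < n, ∀ s, I k s → ∃ s', Runs ω P s (T k) s' ∧ I (k + 1) s')
    {s : State} (h0 : I 0 s) :
    ∃ s', Runs ω (.loop (.idxLt i b) P) s (∑ k ∈ Finset.range n, (T k + 1) + 1) s' ∧ I n s' := by
  -- Induction on the number `m` of remaining rounds, because `Exec.loopTrue` peels off the first
  -- round, not the last.
  suffices H : ∀ m ≤ n, ∀ s, I (n - m) s → ∃ s', Runs ω (.loop (.idxLt i b) P) s
      (∑ k ∈ Finset.Ico (n - m) n, (T k + 1) + 1) s' ∧ I n s' by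
    have := H n le_rfl s (by rwa [Nat.sub_self])
    rwa [Nat.sub_self, ← Finset.range_eq_Ico] at this
  intro m
  induction m with
  | zero =>
    intro _ s hs
    refine ⟨s, ⟨1, by simp, .loopFalse ?_⟩, by simpa using hs⟩
    have := hidx _ _ hs
    simp only [Test.holds]
    omega
  | succ m ih =>
    intro hm s hs
    obtain ⟨s', ⟨t, ht, hex⟩, hs'⟩ := hstep _ (by omega) s hs
    rw [show n - (m + 1) + 1 = n - m by omega] at hs'
    obtain ⟨s'', ⟨t', ht', hex'⟩, hs''⟩ := ih (by omega) s' hs'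
    refine ⟨s'', ⟨t + t' + 1, ?_, .loopTrue ?_ hex hex'⟩, hs''⟩
    · rw [Finset.sum_eq_sum_Ico_succ_bot (by omega),
        show n - (m + 1) + 1 = n - m by omega]
      omega
    · have := hidx _ _ hs
      simp only [Test.holds]
      omega

/-! ### Index expressions -/

/-- The values of the sixteen index variables. -/
abbrev Env := Fin 16 → ℕ

/-- Arithmetic expressions in the index variables. -/
inductive IdxExpr where
  | const (c : ℕ)
  | var (v : Fin 16)
  | add (e f : IdxExpr)
  | sub (e f : IdxExpr)
  | mul (e f : IdxExpr)

namespace IdxExpr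

/-- The value of an index expression. -/
def eval (η : Env) : IdxExpr → ℕ
  | const c => c
  | var v => η v
  | add e f => e.eval η + f.eval η
  | sub e f => e.eval η - f.eval η
  | mul e f => e.eval η * f.eval η

/-- A program that writes the value of the expression into register `r`, using only registers from
`r` on. -/
def compile : IdxExpr → ℕ → Program
  | const c, r => .instr (.idxConst r c)
  | var v, r => .seq (.instr (.idxConst r 0)) (.instr (.idxAdd r v r))
  | add e f, r => .seq (e.compile r) (.seq (f.compile (r + 1)) (.instr (.idxAdd r r (r + 1))))
  | sub e f, r => .seq (e.compile r) (.seq (f.compile (r + 1)) (.instr (.idxSub r r (r + 1))))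
  | mul e f, r => .seq (e.compile (r + 1)) (.seq (f.compile (r + 2))
      (.seq (.instr (.idxConst r 0)) (.seq (.instr (.idxConst (r + 3) 0))
      (.seq (.instr (.idxConst (r + 4) 1)) (.loop (.idxLt (r + 3) (r + 1))
        (.seq (.instr (.idxAdd r r (r + 2))) (.instr (.idxAdd (r + 3) (r + 3) (r + 4)))))))))

/-- A bound for the running time of the compiled expression. -/
def cost (η : Env) : IdxExpr → ℕ
  | const _ => 1
  | var _ => 2
  | add e f => e.cost η + f.cost η + 1
  | sub e f => e.cost η + f.cost η + 1
  | mul e f => e.cost η + f.cost η + 3 * e.eval η + 4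

/-- The registers from `r` on act as a stack: the second operand is evaluated higher up and leaves
the first intact. Registers below `16` hold the variables. There is no multiplication of indices on
the machine, so products are repeated additions, and their cost involves a value. -/
theorem compile_spec (e : IdxExpr) {η : Env} : ∀ {r : ℕ} {s : State}, 16 ≤ r →
    (∀ v : Fin 16, s.idx v = η v) →
    ∃ s', Runs ω (e.compile r) s (e.cost η) s' ∧ s'.idx r = e.eval η ∧
      (∀ q < r, s'.idx q = s.idx q) ∧ s'.mem = s.mem ∧ s'.pos = s.pos := by
  induction e with
  | const c =>
    intro r s hr hs
    refine ⟨_, Runs.instr _ _, ?_⟩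
    simp +contextual [Instr.apply, State.setIdx, eval, ne_of_lt]
  | var v =>
    intro r s hr hs
    refine ⟨_, (Runs.instr _ _).seq (Runs.instr _ _), ?_⟩
    have : (v : ℕ) ≠ r := by omega
    simp +contextual [Instr.apply, State.setIdx, eval, ne_of_lt, this, hs]
  | add e f he hf =>
    intro r s hr hs
    obtain ⟨s₁, h₁, v₁, i₁, m₁, p₁⟩ := he hr hs
    obtain ⟨s₂, h₂, v₂, i₂, m₂, p₂⟩ := hf (r := r + 1) (s := s₁) (by omega)
      (fun v => by rw [i₁ _ (by omega), hs])
    refine ⟨_, (h₁.seq (h₂.seq (Runs.instr _ _))).mono (by simp [cost]; omega), ?_⟩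
    refine ⟨?_, fun q hq => ?_, ?_, ?_⟩
    · simp [Instr.apply, State.setIdx, eval, v₂, i₂, v₁]
    · simp [Instr.apply, State.setIdx, hq.ne, i₂ q (by omega), i₁ q hq]
    · simp [Instr.apply, State.setIdx, m₁, m₂]
    · simp [Instr.apply, State.setIdx, p₁, p₂]
  | sub e f he hf =>
    intro r s hr hs
    obtain ⟨s₁, h₁, v₁, i₁, m₁, p₁⟩ := he hr hs
    obtain ⟨s₂, h₂, v₂, i₂, m₂, p₂⟩ := hf (r := r + 1) (s := s₁) (by omega)
      (fun v => by rw [i₁ _ (by omega), hs])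
    refine ⟨_, (h₁.seq (h₂.seq (Runs.instr _ _))).mono (by simp [cost]; omega), ?_⟩
    refine ⟨?_, fun q hq => ?_, ?_, ?_⟩
    · simp [Instr.apply, State.setIdx, eval, v₂, i₂, v₁]
    · simp [Instr.apply, State.setIdx, hq.ne, i₂ q (by omega), i₁ q hq]
    · simp [Instr.apply, State.setIdx, m₁, m₂]
    · simp [Instr.apply, State.setIdx, p₁, p₂]
  | mul e f he hf =>
    intro r s hr hs
    obtain ⟨s₁, h₁, v₁, i₁, m₁, p₁⟩ := he (r := r + 1) (by omega) hs
    obtain ⟨s₂, h₂, v₂, i₂, m₂, p₂⟩ := hf (r := r + 2) (s := s₁) (by omega)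
      (fun v => by rw [i₁ _ (by omega), hs])
    obtain ⟨s₃, h₃, e₃⟩ := Runs.loop_counter (ω := ω) (i := r + 3) (b := r + 1) (n := e.eval η)
      (P := .seq (.instr (.idxAdd r r (r + 2))) (.instr (.idxAdd (r + 3) (r + 3) (r + 4))))
      (T := fun _ => 2)
      (s := Instr.apply ω (Instr.apply ω (Instr.apply ω s₂ (.idxConst r 0))
        (.idxConst (r + 3) 0)) (.idxConst (r + 4) 1))
      -- Register `r` accumulates the product, `r + 3` counts the rounds, and `r + 4` holds the
      -- increment.
      (fun k t => t.idx (r + 3) = k ∧ t.idx (r + 1) = e.eval η ∧ t.idx (r + 2) = f.eval η ∧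
        t.idx (r + 4) = 1 ∧ t.idx r = k * f.eval η ∧ (∀ q < r, t.idx q = s.idx q) ∧
        t.mem = s.mem ∧ t.pos = s.pos)
      (fun k t ht => ⟨ht.1, ht.2.1⟩)
      (by
        rintro k - t ⟨a₁, a₂, a₃, a₄, a₅, a₆, a₇, a₈⟩
        refine ⟨_, (Runs.instr _ _).seq (Runs.instr _ _), ?_⟩
        simp +contextual [Instr.apply, State.setIdx, Function.update_apply, a₁, a₂, a₃, a₄, a₅,
          a₆, a₇, a₈, add_mul, ne_of_lt]
        intro q hq h
        omega)
      (by
        have h1 : s₂.idx (r + 1) = s₁.idx (r + 1) := i₂ _ (by omega)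
        have h2 : ∀ q < r, s₂.idx q = s.idx q := fun q hq => by
          rw [i₂ _ (by omega), i₁ _ (by omega)]
        simp +contextual [Instr.apply, State.setIdx, Function.update_apply, v₂, h1, v₁, h2,
          m₁, m₂, p₁, p₂, ne_of_lt]
        intro q hq
        rw [if_neg (by omega), if_neg (by omega)])
    refine ⟨s₃, (h₁.seq (h₂.seq ((Runs.instr _ _).seq ((Runs.instr _ _).seq
      ((Runs.instr _ _).seq h₃))))).mono ?_, ?_, ?_, ?_, ?_⟩
    · simp [cost]; omega
    · simpa [eval] using e₃.2.2.2.2.1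
    · exact e₃.2.2.2.2.2.1
    · exact e₃.2.2.2.2.2.2.1
    · exact e₃.2.2.2.2.2.2.2

end IdxExpr

/-! ### Counting loops over an index variable -/

/-- Run `body` for `v = 0, …, n - 1`, and restore `v`. Registers `r`, `r + 1`, `r + 2` are used for
the bound, the old value of `v`, and the constant one. -/
def forProgram (v : Fin 16) (n : IdxExpr) (r : ℕ) (body : Program) : Program :=
  .seq (n.compile r) (.seq (.instr (.idxConst (r + 1) 0)) (.seq (.instr (.idxAdd (r + 1) v (r + 1)))
    (.seq (.instr (.idxConst (r + 2) 1)) (.seq (.instr (.idxConst v 0))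
    (.seq (.loop (.idxLt v r) (.seq body (.instr (.idxAdd v v (r + 2)))))
    (.seq (.instr (.idxConst r 0)) (.instr (.idxAdd v (r + 1) r))))))))

/-- The invariant `J` speaks only of memory and sample counter. The registers are handled here once
and for all: the body may spoil those from `r + 3` on, and `v` is restored, so that loops can be
nested. -/
theorem forProgram_spec {v : Fin 16} {n : IdxExpr} {r B : ℕ} {body : Program} {η : Env}
    {T : ℕ → ℕ} (J : ℕ → (ℕ → ℝ) → ℕ → Prop) (hr : 17 ≤ r)
    (hstep : ∀ k < n.eval η, ∀ s : State, (∀ u : Fin 16, s.idx u = Function.update η v k u) →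
      s.idx 16 = B → J k s.mem s.pos → ∃ s', Runs ω body s (T k) s' ∧
        (∀ q < r + 3, s'.idx q = s.idx q) ∧ J (k + 1) s'.mem s'.pos)
    {s : State} (hs : ∀ u : Fin 16, s.idx u = η u) (hB : s.idx 16 = B) (h0 : J 0 s.mem s.pos) :
    ∃ s', Runs ω (forProgram v n r body) s
      (n.cost η + ∑ k ∈ Finset.range (n.eval η), (T k + 2) + 7) s' ∧
      (∀ q < r, s'.idx q = s.idx q) ∧ J (n.eval η) s'.mem s'.pos := by
  have hvr : (v : ℕ) ≠ r := by omega
  have hvr1 : (v : ℕ) ≠ r + 1 := by omega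
  have hvr2 : (v : ℕ) ≠ r + 2 := by omega
  obtain ⟨s₁, h₁, v₁, i₁, m₁, p₁⟩ := n.compile_spec (ω := ω) (r := r) (by omega) hs
  obtain ⟨s₂, h₂, e₂⟩ := Runs.loop_counter (ω := ω) (i := v) (b := r) (n := n.eval η)
    (P := .seq body (.instr (.idxAdd v v (r + 2)))) (T := fun k => T k + 1)
    (s := Instr.apply ω (Instr.apply ω (Instr.apply ω (Instr.apply ω s₁ (.idxConst (r + 1) 0))
      (.idxAdd (r + 1) v (r + 1))) (.idxConst (r + 2) 1)) (.idxConst v 0))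
    (fun k t => t.idx v = k ∧ t.idx r = n.eval η ∧ t.idx (r + 1) = η v ∧ t.idx (r + 2) = 1 ∧
      (∀ q < r, q ≠ v → t.idx q = s.idx q) ∧ J k t.mem t.pos)
    (fun k t ht => ⟨ht.1, ht.2.1⟩)
    (by
      rintro k hk t ⟨a₁, a₂, a₃, a₄, a₅, a₆⟩
      obtain ⟨t', ht', hi, hJ⟩ := hstep k hk t (fun u => by
          rw [Function.update_apply]
          split_ifs with h
          · rw [h, a₁]
          · rw [a₅ _ (by omega) (by simpa [Fin.ext_iff] using h), hs])
        (by rw [a₅ _ (by omega) (by omega), hB]) a₆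
      refine ⟨_, ht'.seq (Runs.instr _ _), ?_⟩
      refine ⟨?_, ?_, ?_, ?_, fun q hq hqv => ?_, ?_⟩
      · simp [Instr.apply, State.setIdx, hi, a₄, hi v (by omega), a₁]
      · simp [Instr.apply, State.setIdx, hvr.symm, hi, a₂]
      · simp [Instr.apply, State.setIdx, hvr1.symm, hi, a₃]
      · simp [Instr.apply, State.setIdx, hvr2.symm, hi, a₄]
      · simp [Instr.apply, State.setIdx, hqv, hi q (by omega), a₅ q hq hqv]
      · simpa [Instr.apply, State.setIdx] using hJ)
    (by
      refine ⟨?_, ?_, ?_, ?_, fun q hq hqv => ?_, ?_⟩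
      · simp [Instr.apply, State.setIdx]
      · simp [Instr.apply, State.setIdx, Function.update_apply, hvr.symm, v₁]
      · simp [Instr.apply, State.setIdx, hvr1, hvr1.symm, i₁ v (by omega),
          hs]
      · simp [Instr.apply, State.setIdx, Function.update_apply, hvr2.symm]
      · simp [Instr.apply, State.setIdx, Function.update_apply, hqv, i₁ q hq,
          show q ≠ r + 1 by omega,
          show q ≠ r + 2 by omega]
      · simpa [Instr.apply, State.setIdx, m₁, p₁] using h0)
  obtain ⟨b₁, b₂, b₃, b₄, b₅, b₆⟩ := e₂
  refine ⟨_, (h₁.seq ((Runs.instr _ _).seq ((Runs.instr _ _).seq ((Runs.instr _ _).seq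
      ((Runs.instr _ _).seq (h₂.seq ((Runs.instr _ _).seq (Runs.instr _ _)))))))).mono ?_,
      fun q hq => ?_, ?_⟩
  · simp only [add_assoc, Nat.reduceAdd]
    omega
  · by_cases hqv : q = v
    · simp [Instr.apply, State.setIdx, hqv, b₃, hs]
    · simp [Instr.apply, State.setIdx, hqv, b₅ q hq hqv, hq.ne]
  · simpa [Instr.apply, State.setIdx] using b₆

/-! ### Real expressions -/

/-- The real arithmetic operations. -/
inductive Op where
  | add
  | sub
  | mul
  | div

/-- The instruction performing an operation. -/
def Op.instr : Op → ℕ → ℕ → ℕ → Instr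
  | .add => .add
  | .sub => .sub
  | .mul => .mul
  | .div => .div

/-- The value of an operation. -/
noncomputable def Op.eval : Op → ℝ → ℝ → ℝ
  | .add => (· + ·)
  | .sub => (· - ·)
  | .mul => (· * ·)
  | .div => (· / ·)

theorem Op.apply_instr (o : Op) (s : State) (i j k : ℕ) :
    (o.instr i j k).apply ω s = s.setMem i (o.eval (s.get j) (s.get k)) := by
  cases o <;> rfl

/-- Real expressions over the memory, with finite sums. -/
inductive RealExpr where
  | cast (e : IdxExpr)
  | load (a : IdxExpr)
  | op (o : Op) (e f : RealExpr)
  | sum (v : Fin 16) (n : IdxExpr) (e : RealExpr)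

namespace RealExpr

/-- The value of a real expression. -/
noncomputable def eval (m : ℕ → ℝ) : RealExpr → Env → ℝ
  | cast e, η => e.eval η
  | load a, η => m (a.eval η)
  | op o e f, η => o.eval (e.eval m η) (f.eval m η)
  | sum v n e, η => ∑ k ∈ Finset.range (n.eval η), e.eval m (Function.update η v k)

/-- All cells that are read have addresses below `B`. -/
def Bounded (B : ℕ) : RealExpr → Env → Prop
  | cast _, _ => True
  | load a, η => a.eval η < B
  | op _ e f, η => e.Bounded B η ∧ f.Bounded B η
  | sum v n e, η => ∀ k < n.eval η, e.Bounded B (Function.update η v k)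

/-- A program that writes the value of the expression into the `k`-th scratch cell. The address of
the zeroth scratch cell is in register `16`, and registers from `r` on are used. -/
def compile : RealExpr → ℕ → ℕ → Program
  | cast e, k, r => .seq (e.compile r) (.seq (.instr (.idxConst (r + 1) k))
      (.seq (.instr (.idxAdd (r + 1) 16 (r + 1))) (.instr (.cast (r + 1) r))))
  | load a, k, r => .seq (a.compile r) (.seq (.instr (.idxConst (r + 1) k))
      (.seq (.instr (.idxAdd (r + 1) 16 (r + 1))) (.seq (.instr (.idxConst (r + 2) 0))
      (.seq (.instr (.cast (r + 1) (r + 2))) (.instr (.add (r + 1) (r + 1) r))))))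
  | op o e f, k, r => .seq (e.compile k r) (.seq (f.compile (k + 1) r)
      (.seq (.instr (.idxConst r k)) (.seq (.instr (.idxAdd r 16 r))
      (.seq (.instr (.idxConst (r + 1) (k + 1))) (.seq (.instr (.idxAdd (r + 1) 16 (r + 1)))
      (.instr (o.instr r r (r + 1))))))))
  | sum v n e, k, r => .seq (.instr (.idxConst r k)) (.seq (.instr (.idxAdd r 16 r))
      (.seq (.instr (.idxConst (r + 1) 0)) (.seq (.instr (.cast r (r + 1)))
      (forProgram v n r (.seq (e.compile (k + 1) (r + 3)) (.seq (.instr (.idxConst (r + 3) k))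
        (.seq (.instr (.idxAdd (r + 3) 16 (r + 3))) (.seq (.instr (.idxConst (r + 4) (k + 1)))
        (.seq (.instr (.idxAdd (r + 4) 16 (r + 4)))
        (.instr (.add (r + 3) (r + 3) (r + 4))))))))))))

/-- A bound for the running time of the compiled expression. -/
def cost : RealExpr → Env → ℕ
  | cast e, η => e.cost η + 3
  | load a, η => a.cost η + 5
  | op _ e f, η => e.cost η + f.cost η + 5
  | sum v n e, η => n.cost η +
      ∑ k ∈ Finset.range (n.eval η), (e.cost (Function.update η v k) + 7) + 11

/-- The cells from `B` on form a stack of intermediate results: evaluation at depth `k` leaves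
everything below `B + k` unchanged. The expression reads only below `B`, so agreement with `m` is
required there alone. -/
theorem compile_spec (e : RealExpr) {B : ℕ} {m : ℕ → ℝ} : ∀ {η : Env} {k r : ℕ} {s : State},
    17 ≤ r → (∀ v : Fin 16, s.idx v = η v) → s.idx 16 = B → e.Bounded B η →
    (∀ a < B, s.mem a = m a) →
    ∃ s', Runs ω (e.compile k r) s (e.cost η) s' ∧ (∀ q < r, s'.idx q = s.idx q) ∧
      (∀ a < B + k, s'.mem a = s.mem a) ∧ s'.mem (B + k) = e.eval m η ∧ s'.pos = s.pos := by
  induction e with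
  | cast e =>
    intro η k r s hr hs hB hb hm
    obtain ⟨s₁, h₁, v₁, i₁, m₁, p₁⟩ := e.compile_spec (ω := ω) (r := r) (by omega) hs
    refine ⟨_, (h₁.seq ((Runs.instr _ _).seq ((Runs.instr _ _).seq (Runs.instr _ _)))), ?_⟩
    have h16 : s₁.idx 16 = B := by rw [i₁ _ (by omega), hB]
    have hr1 : 16 ≠ r + 1 := by omega
    refine ⟨fun q hq => ?_, fun a ha => ?_, ?_, ?_⟩
    · simp [Instr.apply, State.setIdx, State.setMem, Function.update_apply, i₁ q hq,
        show q ≠ r + 1 by omega]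
    · simp [Instr.apply, State.setIdx, State.setMem, m₁, h16, hr1, ha.ne]
    · simp [Instr.apply, State.setIdx, State.setMem, h16, hr1, v₁, eval]
    · simp [Instr.apply, State.setIdx, State.setMem, p₁]
  | load e =>
    intro η k r s hr hs hB hb hm
    obtain ⟨s₁, h₁, v₁, i₁, m₁, p₁⟩ := e.compile_spec (ω := ω) (r := r) (by omega) hs
    refine ⟨_, (h₁.seq ((Runs.instr _ _).seq ((Runs.instr _ _).seq ((Runs.instr _ _).seq
      ((Runs.instr _ _).seq (Runs.instr _ _)))))), ?_⟩
    have h16 : s₁.idx 16 = B := by rw [i₁ _ (by omega), hB]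
    have hr1 : 16 ≠ r + 1 := by omega
    have hb' : e.eval η < B := hb
    refine ⟨fun q hq => ?_, fun a ha => ?_, ?_, ?_⟩
    · simp [Instr.apply, State.setIdx, State.setMem, Function.update_apply, i₁ q hq,
        show q ≠ r + 1 by omega, show q ≠ r + 2 by omega]
    · simp [Instr.apply, State.setIdx, State.setMem, m₁, h16, hr1, ha.ne]
    -- The target cell is cleared before the loaded cell is added to it, so the two must differ; the
    -- loaded address lies below `B`.
    · simp [Instr.apply, State.setIdx, State.setMem, State.get, h16, hr1,
        v₁, eval, m₁, show e.eval η ≠ B + k by omega, hm _ hb']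
    · simp [Instr.apply, State.setIdx, State.setMem, p₁]
  | op o e f he hf =>
    intro η k r s hr hs hB hb hm
    obtain ⟨s₁, h₁, i₁, m₁, v₁, p₁⟩ := he (k := k) hr hs hB hb.1 hm
    obtain ⟨s₂, h₂, i₂, m₂, v₂, p₂⟩ := hf (k := k + 1) (s := s₁) hr
      (fun v => by rw [i₁ _ (by omega), hs]) (by rw [i₁ _ (by omega), hB]) hb.2
      (fun a ha => by rw [m₁ _ (by omega), hm _ ha])
    refine ⟨_, (h₁.seq (h₂.seq ((Runs.instr _ _).seq ((Runs.instr _ _).seq ((Runs.instr _ _).seq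
      ((Runs.instr _ _).seq (Runs.instr _ _))))))).mono (by simp [cost]; omega), ?_⟩
    have h16 : s₂.idx 16 = B := by rw [i₂ _ (by omega), i₁ _ (by omega), hB]
    have hr0 : 16 ≠ r := by omega
    have hr1 : 16 ≠ r + 1 := by omega
    rw [Op.apply_instr]
    refine ⟨fun q hq => ?_, fun a ha => ?_, ?_, ?_⟩
    · simp [Instr.apply, State.setIdx, State.setMem, Function.update_apply, i₁ q hq, i₂ q hq,
        show q ≠ r + 1 by omega, hq.ne]
    · simp [Instr.apply, State.setIdx, State.setMem, m₁ a ha,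
        m₂ a (by omega), h16, hr1, hr0, ha.ne]
    · simp [Instr.apply, State.setIdx, State.setMem, State.get, h16, hr1,
        hr0, m₂ (B + k) (by omega), v₁, v₂, eval]
    · simp [Instr.apply, State.setIdx, State.setMem, p₁, p₂]
  | sum v n e he =>
    intro η k r s hr hs hB hb hm
    have hr0 : 16 ≠ r := by omega
    have hr1 : 16 ≠ r + 1 := by omega
    obtain ⟨s₁, h₁, i₁, m₁, v₁, p₁⟩ := forProgram_spec (ω := ω) (v := v) (n := n) (r := r)
      (B := B) (η := η)
      (body := .seq (e.compile (k + 1) (r + 3)) (.seq (.instr (.idxConst (r + 3) k))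
        (.seq (.instr (.idxAdd (r + 3) 16 (r + 3))) (.seq (.instr (.idxConst (r + 4) (k + 1)))
        (.seq (.instr (.idxAdd (r + 4) 16 (r + 4))) (.instr (.add (r + 3) (r + 3) (r + 4))))))))
      (T := fun j => e.cost (Function.update η v j) + 5)
      (s := Instr.apply ω (Instr.apply ω (Instr.apply ω (Instr.apply ω s (.idxConst r k))
        (.idxAdd r 16 r)) (.idxConst (r + 1) 0)) (.cast r (r + 1)))
      (fun j μ p => (∀ a < B + k, μ a = s.mem a) ∧
        μ (B + k) = ∑ i ∈ Finset.range j, e.eval m (Function.update η v i) ∧ p = s.pos)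
      hr
      (by
        rintro j hj t ht htB ⟨c₁, c₂, c₃⟩
        obtain ⟨t', h', i', m', v', p'⟩ := he (η := Function.update η v j) (k := k + 1)
          (r := r + 3) (s := t) (by omega) ht htB (hb j hj)
          (fun a ha => by rw [c₁ a (by omega), hm a ha])
        refine ⟨_, (h'.seq ((Runs.instr _ _).seq ((Runs.instr _ _).seq ((Runs.instr _ _).seq
          ((Runs.instr _ _).seq (Runs.instr _ _)))))), fun q hq => ?_, fun a ha => ?_, ?_, ?_⟩
        · simp [Instr.apply, State.setIdx, State.setMem, Function.update_apply, i' q hq,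
            show q ≠ r + 3 by omega, show q ≠ r + 4 by omega]
        · have h16 : t'.idx 16 = B := by rw [i' _ (by omega), htB]
          simp [Instr.apply, State.setIdx, State.setMem,
            m' a (by omega), h16, show 16 ≠ r + 3 by omega, show 16 ≠ r + 4 by omega, ha.ne,
            c₁ a ha]
        · have h16 : t'.idx 16 = B := by rw [i' _ (by omega), htB]
          simp [Instr.apply, State.setIdx, State.setMem, State.get,
            m' (B + k) (by omega), h16, show 16 ≠ r + 3 by omega, show 16 ≠ r + 4 by omega,
            c₂, v', Finset.sum_range_succ]
        · simp [Instr.apply, State.setIdx, State.setMem, p', c₃])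
      (by
        intro u
        simp [Instr.apply, State.setIdx, State.setMem, Function.update_apply, hs,
          show (u : ℕ) ≠ r by omega, show (u : ℕ) ≠ r + 1 by omega])
      (by simp [Instr.apply, State.setIdx, State.setMem, hr0, hr1, hB])
      (by
        refine ⟨fun a ha => ?_, ?_, ?_⟩
        · simp [Instr.apply, State.setIdx, State.setMem, hB, hr0, ha.ne]
        · simp [Instr.apply, State.setIdx, State.setMem, hB, hr0]
        · simp [Instr.apply, State.setIdx, State.setMem])
    refine ⟨s₁, ((Runs.instr _ _).seq ((Runs.instr _ _).seq ((Runs.instr _ _).seq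
      ((Runs.instr _ _).seq h₁)))).mono ?_, fun q hq => ?_, m₁, v₁, p₁⟩
    · simp only [cost, add_assoc, Nat.reduceAdd]
      omega
    · rw [i₁ q hq]
      simp [Instr.apply, State.setIdx, State.setMem, hq.ne, show q ≠ r + 1 by omega]

end RealExpr

/-! ### Statements -/

/-- Statements of the source language. -/
inductive Stmt where
  | store (a : IdxExpr) (e : RealExpr)
  | sample (a : IdxExpr)
  | seq (S S' : Stmt)
  | loop (v : Fin 16) (n : IdxExpr) (S : Stmt)

namespace Stmt

/-- The effect of a statement on the memory and on the number of samples drawn. -/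
noncomputable def run (ω : ℕ → ℝ) : Stmt → Env → (ℕ → ℝ) × ℕ → (ℕ → ℝ) × ℕ
  | store a e, η, m => (Function.update m.1 (a.eval η) (e.eval m.1 η), m.2)
  | sample a, η, m => (Function.update m.1 (a.eval η) (ω m.2), m.2 + 1)
  | seq S S', η, m => S'.run ω η (S.run ω η m)
  | .loop v n S, η, m =>
      Nat.rec m (fun k m' => S.run ω (Function.update η v k) m') (n.eval η)

/-- All cells that are read or written have addresses below `B`. -/
def Bounded (B : ℕ) : Stmt → Env → Prop
  | store a e, η => a.eval η < B ∧ e.Bounded B η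
  | sample a, η => a.eval η < B
  | seq S S', η => S.Bounded B η ∧ S'.Bounded B η
  | .loop v n S, η => ∀ k < n.eval η, S.Bounded B (Function.update η v k)

/-- Translation of statements to programs. -/
def compile : Stmt → ℕ → Program
  | store a e, r => .seq (e.compile 0 r) (.seq (a.compile r) (.seq (.instr (.idxConst (r + 1) 0))
      (.seq (.instr (.cast r (r + 1))) (.instr (.add r r 16)))))
  | sample a, r => .seq (a.compile r) (.instr (.sample r))
  | seq S S', r => .seq (S.compile r) (S'.compile r)
  | .loop v n S, r => forProgram v n r (S.compile (r + 3))

/-- A bound for the running time of the compiled statement. -/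
def cost : Stmt → Env → ℕ
  | store a e, η => e.cost η + a.cost η + 3
  | sample a, η => a.cost η + 1
  | seq S S', η => S.cost η + S'.cost η
  | .loop v n S, η => n.cost η +
      ∑ k ∈ Finset.range (n.eval η), (S.cost (Function.update η v k) + 2) + 7

/-- The semantics `run` ignores the scratch cells, so machine and semantics are compared only below
`B`; boundedness keeps the two regions apart. -/
theorem compile_spec (S : Stmt) {B : ℕ} : ∀ {m : (ℕ → ℝ) × ℕ} {η : Env} {r : ℕ} {s : State},
    17 ≤ r → (∀ v : Fin 16, s.idx v = η v) → s.idx 16 = B → S.Bounded B η →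
    (∀ a < B, s.mem a = m.1 a) → s.pos = m.2 →
    ∃ s', Runs ω (S.compile r) s (S.cost η) s' ∧ (∀ q < r, s'.idx q = s.idx q) ∧
      (∀ a < B, s'.mem a = (S.run ω η m).1 a) ∧ s'.pos = (S.run ω η m).2 := by
  induction S with
  | store a e =>
    intro m η r s hr hs hB hb hm hp
    obtain ⟨s₁, h₁, i₁, m₁, v₁, p₁⟩ := e.compile_spec (ω := ω) (k := 0) hr hs hB hb.2 hm
    obtain ⟨s₂, h₂, v₂, i₂, m₂, p₂⟩ := a.compile_spec (ω := ω) (r := r) (s := s₁) (η := η)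
      (by omega) (fun v => by rw [i₁ _ (by omega), hs])
    refine ⟨_, (h₁.seq (h₂.seq ((Runs.instr _ _).seq ((Runs.instr _ _).seq
      (Runs.instr _ _))))).mono (by simp [cost]; omega), ?_⟩
    have h16 : s₂.idx 16 = B := by rw [i₂ _ (by omega), i₁ _ (by omega), hB]
    have hr1 : 16 ≠ r + 1 := by omega
    have hb' : a.eval η < B := hb.1
    refine ⟨fun q hq => ?_, fun c hc => ?_, ?_⟩
    · simp [Instr.apply, State.setIdx, State.setMem, i₁ q hq, i₂ q hq,
        show q ≠ r + 1 by omega]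
    · simp only [add_zero] at v₁ m₁
      simp [Instr.apply, State.setIdx, State.setMem, State.get, Function.update_apply, h16, hr1,
        v₂, m₂, v₁, m₁ c hc, hm c hc, run, hb'.ne']
    · simp [Instr.apply, State.setIdx, State.setMem, p₁, p₂, hp, run]
  | sample a =>
    intro m η r s hr hs hB hb hm hp
    obtain ⟨s₂, h₂, v₂, i₂, m₂, p₂⟩ := a.compile_spec (ω := ω) (r := r) (by omega) hs
    refine ⟨_, h₂.seq (Runs.instr _ _), fun q hq => ?_, fun c hc => ?_, ?_⟩
    · simp [Instr.apply, State.setMem, i₂ q hq]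
    · simp [Instr.apply, State.setMem, Function.update_apply, v₂, m₂, hm c hc, run, p₂, hp]
    · simp [Instr.apply, p₂, hp, run]
  | seq S S' hS hS' =>
    intro m η r s hr hs hB hb hm hp
    obtain ⟨s₁, h₁, i₁, m₁, p₁⟩ := hS hr hs hB hb.1 hm hp
    obtain ⟨s₂, h₂, i₂, m₂, p₂⟩ := hS' (s := s₁) hr (fun v => by rw [i₁ _ (by omega), hs])
      (by rw [i₁ _ (by omega), hB]) hb.2 m₁ p₁
    exact ⟨s₂, h₁.seq h₂, fun q hq => by rw [i₂ q hq, i₁ q hq], m₂, p₂⟩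
  | loop v n S hS =>
    intro m η r s hr hs hB hb hm hp
    obtain ⟨s₁, h₁, i₁, m₁, p₁⟩ := forProgram_spec (ω := ω) (v := v) (n := n) (r := r)
      (B := B) (η := η) (body := S.compile (r + 3))
      (T := fun j => S.cost (Function.update η v j)) (s := s)
      (fun j μ p => (∀ a < B, μ a =
        (Nat.rec m (fun k m' => S.run ω (Function.update η v k) m') j : (ℕ → ℝ) × ℕ).1 a) ∧
        p = (Nat.rec m (fun k m' => S.run ω (Function.update η v k) m') j : (ℕ → ℝ) × ℕ).2)
      hr
      (by
        rintro j hj t ht htB ⟨c₁, c₂⟩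
        obtain ⟨t', h', i', m', p'⟩ := hS (r := r + 3) (s := t) (by omega) ht htB (hb j hj) c₁ c₂
        exact ⟨t', h', i', m', p'⟩)
      hs hB ⟨hm, hp⟩
    exact ⟨s₁, h₁, i₁, m₁, p₁⟩

end Stmt
/-! ### Polynomial running time -/

/-- For a base `N ≥ 2`, sums and constants are absorbed into the exponent. Every polynomial bound is
then a pure power of `N`, and the inductions below need no coefficients. -/
theorem add_le_pow {N a b i j : ℕ} (hN : 2 ≤ N) (ha : a ≤ N ^ i) (hb : b ≤ N ^ j) :
    a + b ≤ N ^ (i + j + 1) := by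
  have h1 : N ^ i ≤ N ^ (i + j) := Nat.pow_le_pow_right (by omega) (by omega)
  have h2 : N ^ j ≤ N ^ (i + j) := Nat.pow_le_pow_right (by omega) (by omega)
  calc a + b ≤ N ^ (i + j) * 2 := by omega
    _ ≤ N ^ (i + j) * N := Nat.mul_le_mul_left _ hN
    _ = N ^ (i + j + 1) := (pow_succ _ _).symm

theorem mul_le_pow {N a b i j : ℕ} (ha : a ≤ N ^ i) (hb : b ≤ N ^ j) : a * b ≤ N ^ (i + j) := by
  rw [pow_add]
  exact Nat.mul_le_mul ha hb

theorem const_le_pow {N : ℕ} (hN : 2 ≤ N) (c : ℕ) : c ≤ N ^ c :=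
  (Nat.lt_pow_self (by omega)).le

theorem sum_le_pow {N n i j : ℕ} {f : ℕ → ℕ} (hn : n ≤ N ^ i) (hf : ∀ k < n, f k ≤ N ^ j) :
    ∑ k ∈ Finset.range n, f k ≤ N ^ (i + j) := by
  refine (Finset.sum_le_card_nsmul _ _ _ fun k hk => hf k (Finset.mem_range.1 hk)).trans ?_
  rw [Finset.card_range, smul_eq_mul]
  exact mul_le_pow hn le_rfl

theorem update_le_pow {N n i j k : ℕ} {η : Env} (hN : 2 ≤ N) (hη : ∀ u, η u ≤ N ^ i)
    (hn : n ≤ N ^ j) (hk : k < n) (v u : Fin 16) : Function.update η v k u ≤ N ^ (i + j) := by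
  rw [Function.update_apply]
  split_ifs
  · exact (hk.le.trans hn).trans (Nat.pow_le_pow_right (by omega) (by omega))
  · exact (hη u).trans (Nat.pow_le_pow_right (by omega) (by omega))

theorem IdxExpr.exists_pow_bound (e : IdxExpr) (k : ℕ) : ∃ l, ∀ N ≥ 2, ∀ η : Env,
    (∀ v, η v ≤ N ^ k) → e.eval η ≤ N ^ l ∧ e.cost η ≤ N ^ l := by
  suffices H : ∃ i j, ∀ N ≥ 2, ∀ η : Env,
      (∀ v, η v ≤ N ^ k) → e.eval η ≤ N ^ i ∧ e.cost η ≤ N ^ j by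
    obtain ⟨i, j, H⟩ := H
    refine ⟨i + j, fun N hN η hη => ⟨(H N hN η hη).1.trans ?_, (H N hN η hη).2.trans ?_⟩⟩ <;>
    exact Nat.pow_le_pow_right (by omega) (by omega)
  induction e with
  | const c => exact ⟨c, 1, fun N hN η hη => ⟨const_le_pow hN c, by simp [cost]; omega⟩⟩
  | var v => exact ⟨k, 1, fun N hN η hη => ⟨hη v, by simpa [cost] using hN⟩⟩
  | add e f he hf =>
    obtain ⟨i, j, he⟩ := he
    obtain ⟨i', j', hf⟩ := hf
    exact ⟨_, _, fun N hN η hη => ⟨add_le_pow hN (he N hN η hη).1 (hf N hN η hη).1,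
      add_le_pow hN (add_le_pow hN (he N hN η hη).2 (hf N hN η hη).2) (const_le_pow hN _)⟩⟩
  | sub e f he hf =>
    obtain ⟨i, j, he⟩ := he
    obtain ⟨i', j', hf⟩ := hf
    exact ⟨i, _, fun N hN η hη => ⟨(Nat.sub_le _ _).trans (he N hN η hη).1,
      add_le_pow hN (add_le_pow hN (he N hN η hη).2 (hf N hN η hη).2) (const_le_pow hN _)⟩⟩
  | mul e f he hf =>
    obtain ⟨i, j, he⟩ := he
    obtain ⟨i', j', hf⟩ := hf
    exact ⟨_, _, fun N hN η hη => ⟨mul_le_pow (he N hN η hη).1 (hf N hN η hη).1,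
      add_le_pow hN (add_le_pow hN (add_le_pow hN (he N hN η hη).2 (hf N hN η hη).2)
      (mul_le_pow (const_le_pow hN _) (he N hN η hη).1)) (const_le_pow hN _)⟩⟩

/-- The exponent `k` is generalized because a bound variable can be as large as the number of terms:
inside a sum the environment is only bounded by `N ^ (k + l)`. -/
theorem RealExpr.exists_pow_bound (e : RealExpr) : ∀ k, ∃ l, ∀ N ≥ 2, ∀ η : Env,
    (∀ v, η v ≤ N ^ k) → e.cost η ≤ N ^ l := by
  induction e with
  | cast e =>
    intro k
    obtain ⟨l, h⟩ := e.exists_pow_bound k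
    exact ⟨_, fun N hN η hη => add_le_pow hN (h N hN η hη).2 (const_le_pow hN _)⟩
  | load e =>
    intro k
    obtain ⟨l, h⟩ := e.exists_pow_bound k
    exact ⟨_, fun N hN η hη => add_le_pow hN (h N hN η hη).2 (const_le_pow hN _)⟩
  | op o e f he hf =>
    intro k
    obtain ⟨l, he⟩ := he k
    obtain ⟨l', hf⟩ := hf k
    exact ⟨_, fun N hN η hη => add_le_pow hN (add_le_pow hN (he N hN η hη) (hf N hN η hη))
      (const_le_pow hN _)⟩
  | sum v n e he =>
    intro k
    obtain ⟨l, hn⟩ := n.exists_pow_bound k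
    obtain ⟨l', he⟩ := he (k + l)
    exact ⟨_, fun N hN η hη => add_le_pow hN (add_le_pow hN (hn N hN η hη).2
      (sum_le_pow (hn N hN η hη).1 fun i hi => add_le_pow hN
        (he N hN _ (update_le_pow hN hη (hn N hN η hη).1 hi v)) (const_le_pow hN _)))
      (const_le_pow hN _)⟩

theorem Stmt.exists_pow_bound (S : Stmt) : ∀ k, ∃ l, ∀ N ≥ 2, ∀ η : Env,
    (∀ v, η v ≤ N ^ k) → S.cost η ≤ N ^ l := by
  induction S with
  | store a e =>
    intro k
    obtain ⟨l, ha⟩ := a.exists_pow_bound k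
    obtain ⟨l', he⟩ := e.exists_pow_bound k
    exact ⟨_, fun N hN η hη => add_le_pow hN (add_le_pow hN (he N hN η hη) (ha N hN η hη).2)
      (const_le_pow hN _)⟩
  | sample a =>
    intro k
    obtain ⟨l, ha⟩ := a.exists_pow_bound k
    exact ⟨_, fun N hN η hη => add_le_pow hN (ha N hN η hη).2 (const_le_pow hN _)⟩
  | seq S S' hS hS' =>
    intro k
    obtain ⟨l, hS⟩ := hS k
    obtain ⟨l', hS'⟩ := hS' k
    exact ⟨_, fun N hN η hη => add_le_pow hN (hS N hN η hη) (hS' N hN η hη)⟩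
  | loop v n S hS =>
    intro k
    obtain ⟨l, hn⟩ := n.exists_pow_bound k
    obtain ⟨l', hS⟩ := hS (k + l)
    exact ⟨_, fun N hN η hη => add_le_pow hN (add_le_pow hN (hn N hN η hη).2
      (sum_le_pow (hn N hN η hη).1 fun i hi => add_le_pow hN
        (hS N hN _ (update_le_pow hN hη (hn N hN η hη).1 hi v)) (const_le_pow hN _)))
      (const_le_pow hN _)⟩

/-! ### Complete programs -/

/-- Clear the registers `i, …, i + n`. -/
def clear (i : ℕ) : ℕ → Program
  | 0 => .instr (.idxConst i 0)
  | n + 1 => .seq (.instr (.idxConst (i + (n + 1)) 0)) (clear i n)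

theorem clear_spec (i n : ℕ) : ∀ s : State, Runs ω (clear i n) s (n + 1)
    { s with idx := fun q => if i ≤ q ∧ q ≤ i + n then 0 else s.idx q } := by
  induction n with
  | zero =>
    intro s
    have h : (Instr.idxConst i 0).apply ω s =
        { s with idx := fun q => if i ≤ q ∧ q ≤ i + 0 then 0 else s.idx q } := by
      simp only [Instr.apply, State.setIdx, State.mk.injEq, and_true]
      funext q
      rw [Function.update_apply]
      exact if_congr (by omega) rfl rfl
    exact h ▸ Runs.instr (.idxConst i 0) s
  | succ n ih =>
    intro s
    refine ((Runs.instr (.idxConst (i + (n + 1)) 0) s).seq ?_).mono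
      (T := 1 + (n + 1)) (by omega)
    convert ih _ using 1
    simp only [Instr.apply, State.setIdx, State.mk.injEq, and_true]
    funext q
    rw [Function.update_apply]
    split_ifs <;> first | rfl | omega

/-- Clear the variables that are not input sizes, put the address `sb` of the scratch cells into
register `16`, run `S`, and announce the output address `ob`. -/
def mainProgram (sb ob : IdxExpr) (S : Stmt) : Program :=
  .seq (clear 5 10) (.seq (sb.compile 16) (.seq (S.compile 17) (.seq (ob.compile 17)
    (.seq (.instr (.idxConst 0 0)) (.instr (.idxAdd 0 0 17))))))

/-- The variables `0, …, 4` hold the input sizes, the others are zero. -/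
def sizeEnv (X Y Z D d : ℕ) : Env := ![X, Y, Z, D, d, 0, 0, 0, 0, 0, 0, 0, 0, 0, 0, 0]

/-- The initial content of the registers `5, …, 15` is arbitrary, hence the clearing. All variables
are then at most `N = X + Y + Z + max D d`, and the exponent depends on the program only. -/
theorem mainProgram_spec (sb ob : IdxExpr) (S : Stmt) : ∃ l, ∀ (X Y Z D d : ℕ) (s : State)
    (ω : ℕ → ℝ), 2 ≤ X + Y + Z + max D d →
    s.idx 0 = X → s.idx 1 = Y → s.idx 2 = Z → s.idx 3 = D → s.idx 4 = d →
    S.Bounded (sb.eval (sizeEnv X Y Z D d)) (sizeEnv X Y Z D d) →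
    ∃ s', Runs ω (mainProgram sb ob S) s ((X + Y + Z + max D d) ^ l) s' ∧
      s'.idx 0 = ob.eval (sizeEnv X Y Z D d) ∧ ∀ a < sb.eval (sizeEnv X Y Z D d),
        s'.mem a = (S.run ω (sizeEnv X Y Z D d) (s.mem, s.pos)).1 a := by
  obtain ⟨i, hi⟩ := sb.exists_pow_bound 1
  obtain ⟨j, hj⟩ := ob.exists_pow_bound 1
  obtain ⟨k, hk⟩ := S.exists_pow_bound 1
  have hl : ∃ l, ∀ N ≥ 2, ∀ η : Env, (∀ v, η v ≤ N ^ 1) →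
      10 + 1 + (sb.cost η + (S.cost η + (ob.cost η + (1 + 1)))) ≤ N ^ l :=
    ⟨_, fun N hN η hη => add_le_pow hN (const_le_pow hN _) (add_le_pow hN (hi N hN η hη).2
      (add_le_pow hN (hk N hN η hη) (add_le_pow hN (hj N hN η hη).2 (const_le_pow hN _))))⟩
  obtain ⟨l, hl⟩ := hl
  refine ⟨l, fun X Y Z D d s ω hN h0 h1 h2 h3 h4 hb => ?_⟩
  set N := X + Y + Z + max D d with hNdef
  set η := sizeEnv X Y Z D d with hη
  have hηN : ∀ v, η v ≤ N ^ 1 := by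
    intro v
    rw [pow_one]
    fin_cases v <;> simp [hη, sizeEnv] <;> omega
  have c₀ := clear_spec (ω := ω) 5 10 s
  obtain ⟨s₁, c₁, v₁, i₁, m₁, p₁⟩ := sb.compile_spec (ω := ω) (r := 16) (η := η)
    (s := { s with idx := fun q => if 5 ≤ q ∧ q ≤ 5 + 10 then 0 else s.idx q }) le_rfl (by
      intro v
      fin_cases v <;> simp [hη, sizeEnv, h0, h1, h2, h3, h4])
  have i₁' : ∀ v : Fin 16, s₁.idx v = η v := by
    intro v
    rw [i₁ _ v.2]
    fin_cases v <;> simp [hη, sizeEnv, h0, h1, h2, h3, h4]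
  obtain ⟨s₂, c₂, i₂, m₂, p₂⟩ := S.compile_spec (ω := ω) (r := 17) (m := (s.mem, s.pos))
    le_rfl i₁' v₁ hb (fun a _ => by rw [m₁]) p₁
  obtain ⟨s₃, c₃, v₃, i₃, m₃, p₃⟩ := ob.compile_spec (ω := ω) (r := 17) (η := η) (s := s₂)
    (by omega) (fun v => by rw [i₂ _ (by omega), i₁'])
  refine ⟨_, (c₀.seq (c₁.seq (c₂.seq (c₃.seq
    ((Runs.instr _ _).seq (Runs.instr _ _)))))).mono ?_, ?_, fun a ha => ?_⟩
  · exact hl N hN η hηN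
  · simp [Instr.apply, State.setIdx, v₃]
  · simp [Instr.apply, State.setIdx, m₃, m₂ a ha]

end RealRAM

/-! ### Concentration of the norm of a Gaussian image -/

section Gaussian

open MeasureTheory ProbabilityTheory

/-- The law of a vector of independent standard Gaussians. -/
noncomputable def gaussianVector (D : ℕ) : Measure (Fin D → ℝ) :=
  Measure.infinitePi fun _ => gaussianReal 0 1

instance (D : ℕ) : IsProbabilityMeasure (gaussianVector D) := by
  unfold gaussianVector; infer_instance

/-- The law of a matrix of independent standard Gaussians. -/
noncomputable def gaussianMatrix (d D : ℕ) : Measure (Fin d → Fin D → ℝ) :=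
  Measure.infinitePi fun _ => gaussianVector D

instance (d D : ℕ) : IsProbabilityMeasure (gaussianMatrix d D) := by
  unfold gaussianMatrix; infer_instance

theorem map_sum_gaussianVector {D : ℕ} (v : Fin D → ℝ) (s : Finset (Fin D)) :
    (gaussianVector D).map (∑ a ∈ s, fun g => v a * g a) =
      gaussianReal 0 (∑ a ∈ s, NNReal.mk (v a ^ 2) (sq_nonneg _)) := by
  have hind : iIndepFun (fun a (g : Fin D → ℝ) => v a * g a) (gaussianVector D) :=
    iIndepFun_infinitePi (X := fun a (x : ℝ) => v a * x) (by fun_prop)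
  have hlaw : ∀ a, (gaussianVector D).map (fun g => v a * g a) =
      gaussianReal 0 (NNReal.mk (v a ^ 2) (sq_nonneg _)) := by
    intro a
    have h := gaussianReal_map_const_mul (μ := 0) (v := 1) (v a)
    rw [mul_zero, mul_one] at h
    rw [← h, ← Measure.infinitePi_map_eval (fun _ : Fin D => gaussianReal 0 1) a,
      Measure.map_map (by fun_prop) (by fun_prop)]
    rfl
  induction s using Finset.induction_on with
  | empty =>
    rw [Finset.sum_empty, Finset.sum_empty, gaussianReal_zero_var]
    exact (Measure.map_const (gaussianVector D) (0 : ℝ)).trans (by simp)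
  | insert a s ha ih =>
    rw [Finset.sum_insert ha, Finset.sum_insert ha]
    have := gaussianReal_add_gaussianReal_of_indepFun
      (hind.indepFun_finsetSum_of_notMem (by fun_prop) ha).symm (hlaw a) ih
    rwa [add_zero] at this

theorem map_inner_gaussianVector {D : ℕ} {v : Fin D → ℝ} (hv : ∑ a, v a ^ 2 = 1) :
    (gaussianVector D).map (fun g => ∑ a, v a * g a) = gaussianReal 0 1 := by
  have h := map_sum_gaussianVector v Finset.univ
  have h1 : (∑ a, NNReal.mk (v a ^ 2) (sq_nonneg _)) = 1 := by
    ext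
    rw [NNReal.coe_sum]
    exact hv
  rw [h1] at h
  rw [← h]
  congr 1
  ext g
  simp

/-- Multiplied by the Gaussian density, the integrand is again a Gaussian, with parameter `1 / 2 -
t`. -/
theorem integral_exp_sq_gaussianReal {t : ℝ} (ht : t < 1 / 2) :
    ∫ x, Real.exp (t * x ^ 2) ∂(gaussianReal 0 1) = (Real.sqrt (1 - 2 * t))⁻¹ := by
  rw [integral_gaussianReal_eq_integral_smul one_ne_zero]
  have : ∀ x : ℝ, gaussianPDFReal 0 1 x • Real.exp (t * x ^ 2) =
      (Real.sqrt (2 * Real.pi))⁻¹ * Real.exp (-(1 / 2 - t) * x ^ 2) := by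
    intro x
    rw [gaussianPDFReal, smul_eq_mul, mul_assoc, ← Real.exp_add]
    simp only [NNReal.coe_one, mul_one, sub_zero]
    congr 2
    ring
  simp_rw [this]
  rw [integral_const_mul, integral_gaussian, ← Real.sqrt_inv, ← Real.sqrt_inv,
    ← Real.sqrt_mul (by positivity)]
  congr 1
  have : (1 / 2 - t) ≠ 0 := by linarith
  have : (1 - 2 * t) ≠ 0 := by linarith
  field_simp

/-- After squaring, this is `-log (1 - 2t) ≤ 2t + 4t²`. It bounds the chi-square moment generating
function by a sub-Gaussian one near zero. -/
theorem inv_sqrt_le_exp {t : ℝ} (h1 : -(1 / 4) ≤ t) (h2 : t ≤ 1 / 4) :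
    (Real.sqrt (1 - 2 * t))⁻¹ ≤ Real.exp (t + 2 * t ^ 2) := by
  have key : 1 ≤ (1 - 2 * t) * Real.exp (2 * t + 4 * t ^ 2) := by
    -- For `t ≥ 0` the bound `1 + x + x² / 2 ≤ exp x` suffices; for `t ≤ 0` the bound `exp x ≤ 1 + x
    -- + x²` is applied to `x = -(2t + 4t²)`.
    rcases le_total 0 t with ht | ht
    · have := Real.quadratic_le_exp_of_nonneg (x := 2 * t + 4 * t ^ 2) (by positivity)
      have h3 : 0 ≤ 1 - 2 * t := by linarith
      refine le_trans ?_ (mul_le_mul_of_nonneg_left this h3)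
      have : 0 ≤ t ^ 2 * (1 - 2 * t - 8 * t ^ 2) := by
        apply mul_nonneg (sq_nonneg _); nlinarith
      have : 0 ≤ t ^ 5 := by positivity
      have : t ^ 5 ≤ t ^ 4 := pow_le_pow_of_le_one ht (by linarith) (by norm_num)
      nlinarith [mul_nonneg (pow_nonneg ht 4) h3]
    · have h3 : |-(2 * t + 4 * t ^ 2)| ≤ 1 := by
        rw [abs_le]; constructor <;> nlinarith
      have h4 := (abs_le.1 (Real.abs_exp_sub_one_sub_id_le h3)).2
      have h5 : Real.exp (-(2 * t + 4 * t ^ 2)) ≤ 1 - 2 * t := by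
        have : t ^ 3 * (1 + t) ≤ 0 := mul_nonpos_of_nonpos_of_nonneg
          (by have := pow_nonneg (neg_nonneg.2 ht) 3; nlinarith) (by linarith)
        nlinarith
      calc 1 = Real.exp (-(2 * t + 4 * t ^ 2)) * Real.exp (2 * t + 4 * t ^ 2) := by
            rw [← Real.exp_add]; simp
        _ ≤ _ := mul_le_mul_of_nonneg_right h5 (Real.exp_pos _).le
  have hpos : 0 < 1 - 2 * t := by linarith
  rw [inv_le_iff_one_le_mul₀' (Real.sqrt_pos.2 hpos)]
  rw [show Real.exp (t + 2 * t ^ 2) = Real.sqrt (Real.exp (2 * t + 4 * t ^ 2)) by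
    rw [← Real.exp_half]; congr 1; ring, ← Real.sqrt_mul hpos.le]
  exact Real.one_le_sqrt.2 key

/-- The rows are independent, and the inner product of each with a unit vector is a standard
Gaussian. -/
theorem mgf_normSq_gaussianMatrix {d D : ℕ} {v : Fin D → ℝ} (hv : ∑ a, v a ^ 2 = 1) {t : ℝ}
    (ht : t < 1 / 2) :
    mgf (fun G : Fin d → Fin D → ℝ => ∑ i, (∑ a, v a * G i a) ^ 2) (gaussianMatrix d D) t =
      (Real.sqrt (1 - 2 * t))⁻¹ ^ d := by
  have hind : iIndepFun (fun i (G : Fin d → Fin D → ℝ) => (∑ a, v a * G i a) ^ 2)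
      (gaussianMatrix d D) :=
    iIndepFun_infinitePi (X := fun _ (g : Fin D → ℝ) => (∑ a, v a * g a) ^ 2) (by fun_prop)
  have h := hind.mgf_sum (t := t) (by fun_prop) Finset.univ
  have hrow : ∀ i : Fin d, mgf (fun G : Fin d → Fin D → ℝ => (∑ a, v a * G i a) ^ 2)
      (gaussianMatrix d D) t = (Real.sqrt (1 - 2 * t))⁻¹ := by
    intro i
    have h1 : Measurable fun g : Fin D → ℝ => ∑ a, v a * g a := by fun_prop
    have h2 : Measurable fun G : Fin d → Fin D → ℝ => G i := by fun_prop
    have h3 : Measurable fun g : Fin D → ℝ => Real.exp (t * (∑ a, v a * g a) ^ 2) := by fun_prop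
    rw [← integral_exp_sq_gaussianReal ht, ← map_inner_gaussianVector hv,
      integral_map h1.aemeasurable (by fun_prop),
      ← Measure.infinitePi_map_eval (fun _ : Fin d => gaussianVector D) i,
      integral_map h2.aemeasurable h3.aestronglyMeasurable]
    rfl
  rw [Finset.prod_congr rfl fun i _ => hrow i, Finset.prod_const, Finset.card_univ,
    Fintype.card_fin] at h
  rw [← h]
  congr 1
  ext G
  simp

theorem gaussianMatrix_tail_le {d D : ℕ} {v : Fin D → ℝ} (hv : ∑ a, v a ^ 2 = 1) {δ : ℝ}
    (h0 : 0 ≤ δ) (h1 : δ ≤ 1) :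
    (gaussianMatrix d D).real {G | (1 + δ) * d ≤ ∑ i, (∑ a, v a * G i a) ^ 2} ≤
        Real.exp (-(d * δ ^ 2 / 8)) ∧
      (gaussianMatrix d D).real {G | ∑ i, (∑ a, v a * G i a) ^ 2 ≤ (1 - δ) * d} ≤
        Real.exp (-(d * δ ^ 2 / 8)) := by
  have hint : ∀ t < 1 / 2, Integrable (fun G : Fin d → Fin D → ℝ =>
      Real.exp (t * ∑ i, (∑ a, v a * G i a) ^ 2)) (gaussianMatrix d D) := by
    intro t ht
    -- A function that is not integrable has integral `0` by convention, whereas this integral has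
    -- just been computed to be positive.
    apply Integrable.of_integral_ne_zero
    have := mgf_normSq_gaussianMatrix (d := d) hv ht
    rw [mgf] at this
    rw [this]
    have : 0 < 1 - 2 * t := by linarith
    positivity
  constructor
  -- Chernoff bound with `t = δ / 4`: the exponent is `d (-(δ / 4) (1 + δ) + δ / 4 + δ² / 8) = -d δ²
  -- / 8`. The lower tail uses `t = -δ / 4`.
  · refine (measure_ge_le_exp_mul_mgf (t := δ / 4) _ (by positivity)
      (hint _ (by linarith))).trans ?_
    rw [mgf_normSq_gaussianMatrix hv (by linarith)]
    calc _ ≤ Real.exp (-(δ / 4) * ((1 + δ) * d)) * Real.exp (δ / 4 + 2 * (δ / 4) ^ 2) ^ d := by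
          gcongr
          exact inv_sqrt_le_exp (by linarith) (by linarith)
      _ = _ := by
          rw [← Real.exp_nat_mul, ← Real.exp_add]
          congr 1
          ring
  · refine (measure_le_le_exp_mul_mgf (t := -(δ / 4)) _ (by linarith)
      (hint _ (by linarith))).trans ?_
    rw [mgf_normSq_gaussianMatrix hv (by linarith)]
    calc _ ≤ Real.exp (-(-(δ / 4)) * ((1 - δ) * d)) *
          Real.exp (-(δ / 4) + 2 * (-(δ / 4)) ^ 2) ^ d := by
          gcongr
          exact inv_sqrt_le_exp (by linarith) (by linarith)
      _ = _ := by
          rw [← Real.exp_nat_mul, ← Real.exp_add]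
          congr 1
          ring

/-- Concentration of the norm of a Gaussian image of a real vector. -/
theorem gaussianMatrix_real_concentration {d D : ℕ} (v : Fin D → ℝ) {δ : ℝ} (h0 : 0 ≤ δ)
    (h1 : δ ≤ 1) :
    gaussianMatrix d D {G | ¬ |∑ i, (∑ a, v a * G i a) ^ 2 - d * ∑ a, v a ^ 2| ≤
      δ * (d * ∑ a, v a ^ 2)} ≤ ENNReal.ofReal (2 * Real.exp (-(d * δ ^ 2 / 8))) := by
  rcases (Finset.sum_nonneg fun a _ => sq_nonneg (v a) : 0 ≤ ∑ a, v a ^ 2).eq_or_lt with h | h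
  · have hv : ∀ a, v a = 0 := by
      intro a
      have := (Finset.sum_eq_zero_iff_of_nonneg fun a _ => sq_nonneg (v a)).1 h.symm a
        (Finset.mem_univ a)
      exact pow_eq_zero_iff (two_ne_zero) |>.1 this
    simp [hv]
  set c := ∑ a, v a ^ 2 with hc
  set u : Fin D → ℝ := fun a => v a / Real.sqrt c with hu
  have hs : Real.sqrt c ^ 2 = c := Real.sq_sqrt h.le
  have hu1 : ∑ a, u a ^ 2 = 1 := by
    simp_rw [hu, div_pow, hs, ← Finset.sum_div]
    exact div_self h.ne'
  have hvu : ∀ G : Fin d → Fin D → ℝ,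
      ∑ i, (∑ a, v a * G i a) ^ 2 = c * ∑ i, (∑ a, u a * G i a) ^ 2 := by
    intro G
    rw [Finset.mul_sum]
    refine Finset.sum_congr rfl fun i _ => ?_
    have : ∑ a, u a * G i a = (∑ a, v a * G i a) / Real.sqrt c := by
      rw [Finset.sum_div]
      exact Finset.sum_congr rfl fun a _ => by simp only [hu]; ring
    rw [this, div_pow, hs]
    field_simp
  obtain ⟨hup, hlow⟩ := gaussianMatrix_tail_le (d := d) hu1 h0 h1
  have hsub : {G : Fin d → Fin D → ℝ | ¬ |∑ i, (∑ a, v a * G i a) ^ 2 - d * c| ≤ δ * (d * c)} ⊆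
      {G | (1 + δ) * d ≤ ∑ i, (∑ a, u a * G i a) ^ 2} ∪
      {G | ∑ i, (∑ a, u a * G i a) ^ 2 ≤ (1 - δ) * d} := by
    intro G hG
    by_contra hcon
    simp only [Set.mem_union, Set.mem_ofPred_eq, not_or, not_le] at hcon
    refine hG ?_
    rw [hvu, abs_le]
    constructor <;> nlinarith
  refine (measure_mono hsub).trans ((measure_union_le _ _).trans ?_)
  rw [two_mul, ENNReal.ofReal_add (by positivity) (by positivity)]
  refine add_le_add ?_ ?_
  · rw [← ofReal_measureReal]; exact ENNReal.ofReal_le_ofReal hup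
  · rw [← ofReal_measureReal]; exact ENNReal.ofReal_le_ofReal hlow

/-- Concentration of the norm of a Gaussian image of a complex vector. -/
theorem gaussianMatrix_complex_concentration {d D : ℕ} (w : Fin D → ℂ) {δ : ℝ} (h0 : 0 ≤ δ)
    (h1 : δ ≤ 1) :
    gaussianMatrix d D {G | ¬ |∑ i, ‖∑ a, (G i a : ℂ) * w a‖ ^ 2 - d * ∑ a, ‖w a‖ ^ 2| ≤
      δ * (d * ∑ a, ‖w a‖ ^ 2)} ≤ ENNReal.ofReal (4 * Real.exp (-(d * δ ^ 2 / 8))) := by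
  -- As `G` is real, the real and imaginary parts of `w` are mapped separately and the squared norms
  -- add up; failure for `w` forces failure for one of the parts.
  have hsub : {G : Fin d → Fin D → ℝ | ¬ |∑ i, ‖∑ a, (G i a : ℂ) * w a‖ ^ 2 -
        d * ∑ a, ‖w a‖ ^ 2| ≤ δ * (d * ∑ a, ‖w a‖ ^ 2)} ⊆
      {G | ¬ |∑ i, (∑ a, (w a).re * G i a) ^ 2 - d * ∑ a, (w a).re ^ 2| ≤
        δ * (d * ∑ a, (w a).re ^ 2)} ∪
      {G | ¬ |∑ i, (∑ a, (w a).im * G i a) ^ 2 - d * ∑ a, (w a).im ^ 2| ≤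
        δ * (d * ∑ a, (w a).im ^ 2)} := by
    intro G hG
    by_contra hcon
    simp only [Set.mem_union, Set.mem_ofPred_eq, not_or, not_not] at hcon
    refine hG ?_
    have e1 : ∀ z : ℂ, ‖z‖ ^ 2 = z.re ^ 2 + z.im ^ 2 := fun z => by
      rw [← Complex.normSq_eq_norm_sq, Complex.normSq_apply]; ring
    have e2 : ∑ i, ‖∑ a, (G i a : ℂ) * w a‖ ^ 2 = ∑ i, (∑ a, (w a).re * G i a) ^ 2 +
        ∑ i, (∑ a, (w a).im * G i a) ^ 2 := by
      rw [← Finset.sum_add_distrib]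
      refine Finset.sum_congr rfl fun i _ => ?_
      rw [e1]
      simp [Complex.re_sum, Complex.im_sum, mul_comm]
    have e3 : ∑ a, ‖w a‖ ^ 2 = ∑ a, (w a).re ^ 2 + ∑ a, (w a).im ^ 2 := by
      rw [← Finset.sum_add_distrib]
      exact Finset.sum_congr rfl fun a _ => e1 _
    rw [e2, e3]
    have h2 := abs_le.1 hcon.1
    have h3 := abs_le.1 hcon.2
    rw [abs_le]
    constructor <;> linarith
  refine (measure_mono hsub).trans ((measure_union_le _ _).trans ?_)
  rw [show 4 * Real.exp (-(d * δ ^ 2 / 8)) =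
    2 * Real.exp (-(d * δ ^ 2 / 8)) + 2 * Real.exp (-(d * δ ^ 2 / 8)) by ring,
    ENNReal.ofReal_add (by positivity) (by positivity)]
  exact add_le_add (gaussianMatrix_real_concentration _ h0 h1)
    (gaussianMatrix_real_concentration _ h0 h1)

/-- The matrix formed by the first samples, row by row. -/
def sampleMatrix (d D : ℕ) (ω : ℕ → ℝ) (i : Fin d) (a : Fin D) : ℝ := ω (i * D + a)

theorem mul_add_inj {k p p' q q' : ℕ} (hq : q < k) (hq' : q' < k) (h : p * k + q = p' * k + q') :
    p = p' ∧ q = q' := by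
  have hk : 0 < k := by omega
  have h1 : (p * k + q) / k = p := by
    rw [add_comm, Nat.add_mul_div_right _ _ hk, Nat.div_eq_of_lt hq, zero_add]
  have h2 : (p' * k + q') / k = p' := by
    rw [add_comm, Nat.add_mul_div_right _ _ hk, Nat.div_eq_of_lt hq', zero_add]
  have : p = p' := by rw [← h1, ← h2, h]
  subst this
  exact ⟨rfl, by omega⟩

/-- The entries sit at distinct positions of the tape, hence they are independent; currying turns
the family indexed by pairs into a matrix. -/
theorem map_sampleMatrix (d D : ℕ) :
    RealRAM.gaussians.map (sampleMatrix d D) = gaussianMatrix d D := by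
  have hinj : Function.Injective fun p : Fin d × Fin D => (p.1 * D + p.2 : ℕ) := by
    rintro ⟨i, a⟩ ⟨j, b⟩ h
    obtain ⟨h1, h2⟩ := mul_add_inj a.2 b.2 h
    exact Prod.ext (Fin.ext h1) (Fin.ext h2)
  have h := Measure.map_infinitePi_infinitePi_of_inj (P := fun _ : ℕ => gaussianReal 0 1) hinj
  have h' := Measure.infinitePi_map_curry (fun (_ : Fin d) (_ : Fin D) => gaussianReal 0 1)
  rw [← h, Measure.map_map (by fun_prop) (by fun_prop)] at h'
  exact h'

/-- Only an upper bound for bad events is needed, and this inequality holds without measurability of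
`p`. -/
theorem gaussians_sampleMatrix_le {d D : ℕ} (p : (Fin d → Fin D → ℝ) → Prop) :
    RealRAM.gaussians {ω | p (sampleMatrix d D ω)} ≤ gaussianMatrix d D {G | p G} := by
  rw [← map_sampleMatrix]
  refine Measure.le_map_apply ?_ {G | p G}
  have : Measurable (sampleMatrix d D) := by
    unfold sampleMatrix; fun_prop
  exact this.aemeasurable

end Gaussian

/-! ### Nets in finite-dimensional complex spaces -/

section Net

variable {V F : Type*} [NormedAddCommGroup V] [InnerProductSpace ℂ V] [FiniteDimensional ℂ V]
  [NormedAddCommGroup F] [InnerProductSpace ℂ F]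

/-- Doubling gives a `1`-separated set in the ball of radius `2`, which has at most `5 ^ n` points
in real dimension `n`; here `n` is twice the complex dimension. -/
theorem card_le_of_half_separated (s : Finset V) (hs : ∀ c ∈ s, ‖c‖ ≤ 1)
    (h : ∀ c ∈ s, ∀ c' ∈ s, c ≠ c' → 1 / 2 ≤ ‖c - c'‖) :
    s.card ≤ 25 ^ Module.finrank ℂ V := by
  classical
  have hinj : Function.Injective fun c : V => (2 : ℝ) • c := smul_right_injective V two_ne_zero
  have key := Besicovitch.card_le_of_separated (s.image fun c : V => (2 : ℝ) • c)
    (by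
      intro c hc
      obtain ⟨b, hb, rfl⟩ := Finset.mem_image.1 hc
      rw [norm_smul]
      have := hs b hb
      norm_num
      linarith)
    (by
      intro c hc c' hc' hne
      obtain ⟨b, hb, rfl⟩ := Finset.mem_image.1 hc
      obtain ⟨b', hb', rfl⟩ := Finset.mem_image.1 hc'
      have := h b hb b' hb' (fun h => hne (by rw [h]))
      rw [← smul_sub, norm_smul]
      norm_num
      linarith)
  rw [Finset.card_image_of_injective _ hinj, finrank_real_of_complex, pow_mul] at key
  exact key

/-- A `1 / 2`-net of the unit ball. -/
theorem exists_half_net : ∃ N : Finset V, N.card ≤ 25 ^ Module.finrank ℂ V ∧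
    ∀ x : V, ‖x‖ ≤ 1 → ∃ y ∈ N, ‖x - y‖ < 1 / 2 := by
  classical
  let P : ℕ → Prop := fun n => ∃ s : Finset V, s.card = n ∧ (∀ c ∈ s, ‖c‖ ≤ 1) ∧
    ∀ c ∈ s, ∀ c' ∈ s, c ≠ c' → 1 / 2 ≤ ‖c - c'‖
  have hbound : ∀ n, P n → n ≤ 25 ^ Module.finrank ℂ V := by
    rintro n ⟨s, rfl, h1, h2⟩
    exact card_le_of_half_separated s h1 h2
  have h0 : P 0 := ⟨∅, by simp⟩
  -- A separated set of maximal cardinality is a net, since a point far from all of it could be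
  -- added.
  obtain ⟨s, hcard, h1, h2⟩ := Nat.findGreatest_spec (P := P) (Nat.zero_le _) h0
  refine ⟨s, card_le_of_half_separated s h1 h2, fun x hx => ?_⟩
  by_contra! hcon
  have hxs : x ∉ s := fun hxs => by
    have := hcon x hxs
    norm_num at this
  have hP : P (Nat.findGreatest P (25 ^ Module.finrank ℂ V) + 1) := by
    rw [← hcard]
    refine ⟨insert x s, Finset.card_insert_of_notMem hxs, ?_, ?_⟩
    · intro c hc
      rcases Finset.mem_insert.1 hc with rfl | hc
      exacts [hx, h1 c hc]
    · intro c hc c' hc' hne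
      rcases Finset.mem_insert.1 hc with rfl | hcs <;>
        rcases Finset.mem_insert.1 hc' with rfl | hcs'
      · exact absurd rfl hne
      · exact hcon c' hcs'
      · rw [norm_sub_rev]; exact hcon c hcs
      · exact h2 c hcs c' hcs' hne
  have := Nat.le_findGreatest (hbound _ hP) hP
  omega

/-- A `1 / 4`-net of the unit ball. -/
theorem exists_quarter_net : ∃ N : Finset V, N.card ≤ 625 ^ Module.finrank ℂ V ∧
    ∀ x : V, ‖x‖ ≤ 1 → ∃ y ∈ N, ‖x - y‖ ≤ 1 / 4 := by
  classical
  obtain ⟨N, hN, hnet⟩ := exists_half_net (V := V)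
  -- The half-net is used twice: `y` approximates `x`, and then `z` approximates `2 (x - y)`, which
  -- lies in the unit ball again.
  refine ⟨(N ×ˢ N).image fun p => p.1 + (1 / 2 : ℝ) • p.2, ?_, fun x hx => ?_⟩
  · refine Finset.card_image_le.trans ?_
    rw [Finset.card_product, show 625 = 25 * 25 by norm_num, mul_pow]
    exact Nat.mul_le_mul hN hN
  · obtain ⟨y, hy, hxy⟩ := hnet x hx
    obtain ⟨z, hz, hxz⟩ := hnet ((2 : ℝ) • (x - y)) (by
      rw [norm_smul]; norm_num; linarith)
    refine ⟨y + (1 / 2 : ℝ) • z,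
      Finset.mem_image.2 ⟨(y, z), Finset.mem_product.2 ⟨hy, hz⟩, rfl⟩, ?_⟩
    rw [show x - (y + (1 / 2 : ℝ) • z) = (1 / 2 : ℝ) • ((2 : ℝ) • (x - y) - z) by
      rw [smul_sub, smul_smul]; norm_num; abel, norm_smul]
    norm_num
    linarith

theorem re_inner_smul_smul (s t : ℝ) (a b : F) :
    RCLike.re (inner ℂ (s • a) (t • b)) = s * t * RCLike.re (inner ℂ a b) := by
  rw [← Complex.coe_smul, ← Complex.coe_smul t, inner_smul_left, inner_smul_right]
  simp [mul_assoc]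

/-- If a linear map almost preserves the norms of the points of a net, then it almost preserves
all norms. -/
theorem exists_net_almost_isometry (V : Type*) [NormedAddCommGroup V] [InnerProductSpace ℂ V]
    [FiniteDimensional ℂ V] :
    ∃ N : Finset V, N.card ≤ 625 ^ Module.finrank ℂ V ∧
      ∀ (T : V →ₗ[ℂ] F) (δ : ℝ), (∀ y ∈ N, |‖T y‖ ^ 2 - ‖y‖ ^ 2| ≤ δ * ‖y‖ ^ 2) →
        0 ≤ δ → ∀ v, |‖T v‖ ^ 2 - ‖v‖ ^ 2| ≤ 4 * δ * ‖v‖ ^ 2 := by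
  obtain ⟨N, hN, hnet⟩ := exists_quarter_net (V := V)
  refine ⟨N, hN, fun T δ hT hδ => ?_⟩
  set q : V → ℝ := fun v => ‖T v‖ ^ 2 - ‖v‖ ^ 2 with hq
  have hTs : ∀ (t : ℝ) (v : V), T (t • v) = t • T v := fun t v => by
    rw [← Complex.coe_smul, map_smul, Complex.coe_smul]
  have hqs : ∀ (t : ℝ) (v : V), q (t • v) = t ^ 2 * q v := by
    intro t v
    simp only [hq, hTs, norm_smul, mul_pow, Real.norm_eq_abs, sq_abs]
    ring
  have hproper : ProperSpace V := FiniteDimensional.proper ℂ V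
  have hTc : Continuous T := T.continuous_of_finiteDimensional
  have hcont : Continuous fun v => |q v| := by fun_prop
  obtain ⟨x, hx, hmax⟩ := (isCompact_closedBall (0 : V) 1).exists_isMaxOn
    ⟨0, by simp⟩ hcont.continuousOn
  set M := |q x| with hM
  have hM0 : 0 ≤ M := abs_nonneg _
  have hqM : ∀ v, |q v| ≤ M * ‖v‖ ^ 2 := by
    intro v
    rcases eq_or_ne v 0 with rfl | hv
    · simp [hq]
    have hv' : ‖v‖ ≠ 0 := norm_ne_zero_iff.2 hv
    have h1 : |q (‖v‖⁻¹ • v)| ≤ M := hmax (by simp [norm_smul, hv'])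
    rw [hqs, abs_mul, abs_of_nonneg (sq_nonneg _)] at h1
    calc |q v| = ‖v‖ ^ 2 * (‖v‖⁻¹ ^ 2 * |q v|) := by field_simp
      _ ≤ ‖v‖ ^ 2 * M := by gcongr
      _ = _ := mul_comm _ _
  have hx1 : ‖x‖ ≤ 1 := by simpa using hx
  obtain ⟨y, hy, hxy⟩ := hnet x hx1
  have hpol : ∀ u w : V, q (u + w) - q (u - w) =
      4 * (RCLike.re (inner ℂ (T u) (T w)) - RCLike.re (inner ℂ u w)) := by
    intro u w
    simp only [hq, map_add, map_sub]
    rw [norm_add_sq (𝕜 := ℂ), norm_add_sq (𝕜 := ℂ), norm_sub_sq (𝕜 := ℂ), norm_sub_sq (𝕜 := ℂ)]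
    ring
  -- The left side is four times a real bilinear form in `(u, w)`, unchanged under `(3 u, w / 3)`.
  -- The scaling balances the bounds `‖u‖ ≤ 1 / 4` and `‖w‖ ≤ 9 / 4` for `u = x - y`, `w = x + y`.
  have hpol' : ∀ u w : V, q (u + w) - q (u - w) =
      q ((3 : ℝ) • u + (1 / 3 : ℝ) • w) - q ((3 : ℝ) • u - (1 / 3 : ℝ) • w) := by
    intro u w
    rw [hpol, hpol]
    rw [hTs, hTs, re_inner_smul_smul, re_inner_smul_smul]
    norm_num
  set u := x - y with hu
  set w := x + y with hw
  have hy1 : ‖y‖ ≤ 5 / 4 := by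
    have := norm_sub_norm_le y x
    rw [norm_sub_rev] at this
    linarith
  have hw1 : ‖w‖ ≤ 9 / 4 := (norm_add_le _ _).trans (by linarith)
  have e1 : q (u + w) - q (u - w) = 4 * (q x - q y) := by
    rw [show u + w = (2 : ℝ) • x by rw [hu, hw, two_smul]; abel,
      show u - w = (-2 : ℝ) • y by rw [hu, hw, neg_smul, two_smul]; abel, hqs, hqs]
    ring
  have e2 : ‖(3 : ℝ) • u + (1 / 3 : ℝ) • w‖ ^ 2 + ‖(3 : ℝ) • u - (1 / 3 : ℝ) • w‖ ^ 2 =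
      2 * (9 * ‖u‖ ^ 2 + 1 / 9 * ‖w‖ ^ 2) := by
    rw [norm_add_sq (𝕜 := ℂ), norm_sub_sq (𝕜 := ℂ), norm_smul, norm_smul]
    norm_num
    ring
  have hu2 : ‖u‖ ^ 2 ≤ 1 / 16 := by nlinarith [norm_nonneg u]
  have hw2 : ‖w‖ ^ 2 ≤ 81 / 16 := by nlinarith [norm_nonneg w]
  have hy2 : ‖y‖ ^ 2 ≤ 25 / 16 := by nlinarith [norm_nonneg y]
  have h3 := hqM ((3 : ℝ) • u + (1 / 3 : ℝ) • w)
  have h4 := hqM ((3 : ℝ) • u - (1 / 3 : ℝ) • w)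
  have h5 : |4 * (q x - q y)| ≤ M * (9 / 4) := by
    rw [← e1, hpol']
    refine (abs_sub _ _).trans ((add_le_add h3 h4).trans ?_)
    rw [← mul_add, e2]
    exact mul_le_mul_of_nonneg_left (by linarith) hM0
  have h6 : |q y| ≤ δ * (25 / 16) :=
    (hT y hy).trans (mul_le_mul_of_nonneg_left hy2 hδ)
  -- By `h5`, `|q x - q y| ≤ (9 / 16) M`, and by `h6`, `|q y| ≤ (25 / 16) δ`; hence `(7 / 16) M ≤
  -- (25 / 16) δ`.
  have h7 : M ≤ 4 * δ := by
    rw [abs_mul, abs_of_pos (by norm_num : (0 : ℝ) < 4)] at h5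
    have h8 : M ≤ |q x - q y| + |q y| := by
      rw [hM]
      simpa using abs_add_le (q x - q y) (q y)
    linarith
  intro v
  exact (hqM v).trans (mul_le_mul_of_nonneg_right h7 (sq_nonneg _))

end Net

/-! ### The compressed states and effects for a fixed matrix `G` -/

section Sketch

open Matrix

/-- A real matrix, with complex entries. -/
def complexMatrix {d D : ℕ} (G : Fin d → Fin D → ℝ) : Matrix (Fin d) (Fin D) ℂ :=
  Matrix.of fun i a => (G i a : ℂ)

/-- The matrix `G / √d` preserves the squared norm of `w` up to a relative error `δ`. -/
def AlmostPreserves {d D : ℕ} (G : Fin d → Fin D → ℝ) (δ : ℝ) (w : EuclideanSpace ℂ (Fin D)) :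
    Prop :=
  |‖toEuclideanLin (complexMatrix G) w‖ ^ 2 - d * ‖w‖ ^ 2| ≤ δ * (d * ‖w‖ ^ 2)

theorem gaussianMatrix_almostPreserves {d D : ℕ} (w : EuclideanSpace ℂ (Fin D)) {δ : ℝ}
    (h0 : 0 ≤ δ) (h1 : δ ≤ 1) :
    gaussianMatrix d D {G | ¬ AlmostPreserves G δ w} ≤
      ENNReal.ofReal (4 * Real.exp (-(d * δ ^ 2 / 8))) := by
  convert gaussianMatrix_complex_concentration (d := d) w.ofLp h0 h1 using 5
  rw [AlmostPreserves, EuclideanSpace.norm_sq_eq, EuclideanSpace.norm_sq_eq]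
  rfl

/-- A matrix that almost preserves the norms of the four vectors in the polarization identity almost
preserves the inner product. -/
theorem inner_almost_preserved {d D : ℕ} {G : Fin d → Fin D → ℝ} {δ : ℝ}
    {x y : EuclideanSpace ℂ (Fin D)} (hx : ‖x‖ = 1) (hy : ‖y‖ = 1)
    (h : ∀ k : Fin 4, AlmostPreserves G δ (x + Complex.I ^ (k : ℕ) • y)) :
    ‖inner ℂ (toEuclideanLin (complexMatrix G) x) (toEuclideanLin (complexMatrix G) y) -
      d * inner ℂ x y‖ ≤ 2 * δ * d := by
  set T := toEuclideanLin (complexMatrix G) with hT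
  have e : ∀ k : Fin 4, ‖T x + Complex.I ^ (k : ℕ) • T y‖ =
      ‖T (x + Complex.I ^ (k : ℕ) • y)‖ := fun k => by rw [map_add, map_smul]
  set a : Fin 4 → ℝ := fun k => ‖T x + Complex.I ^ (k : ℕ) • T y‖ ^ 2 -
    d * ‖x + Complex.I ^ (k : ℕ) • y‖ ^ 2 with ha
  have h1 : ∀ k, |a k| ≤ δ * (d * ‖x + Complex.I ^ (k : ℕ) • y‖ ^ 2) := fun k => by
    rw [ha]; simp only; rw [e]; exact h k
  have h2 : inner ℂ (T x) (T y) - d * inner ℂ x y =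
      ((a 0 - a 2 : ℂ) + (a 3 - a 1) * Complex.I) / 4 := by
    rw [inner_eq_sum_norm_sq_div_four, inner_eq_sum_norm_sq_div_four x y]
    have i3 : Complex.I ^ 3 = -Complex.I := Complex.I_pow_three
    simp only [ha, Fin.isValue, Fin.val_zero, pow_zero, one_smul, Fin.val_one, pow_one,
      show ((2 : Fin 4) : ℕ) = 2 from rfl, show ((3 : Fin 4) : ℕ) = 3 from rfl, Complex.I_sq, i3,
      neg_smul, ← sub_eq_add_neg]
    push_cast
    simp only [RCLike.I_to_complex, Complex.coe_algebraMap]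
    ring
  -- By the parallelogram law the four squared norms add up to `8`, so the division by `4` in the
  -- polarization identity leaves `2 δ d`.
  have h3 : ‖x + Complex.I ^ (0 : ℕ) • y‖ ^ 2 + ‖x + Complex.I ^ (2 : ℕ) • y‖ ^ 2 = 4 ∧
      ‖x + Complex.I ^ (1 : ℕ) • y‖ ^ 2 + ‖x + Complex.I ^ (3 : ℕ) • y‖ ^ 2 = 4 := by
    constructor
    · rw [norm_add_sq (𝕜 := ℂ), norm_add_sq (𝕜 := ℂ)]
      simp [hx, hy]
      ring
    · rw [norm_add_sq (𝕜 := ℂ), norm_add_sq (𝕜 := ℂ), Complex.I_pow_three]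
      simp [norm_smul, hx, hy]
      ring
  rw [h2, norm_div]
  have h4 : ‖(a 0 - a 2 : ℂ) + (a 3 - a 1) * Complex.I‖ ≤ |a 0| + |a 2| + (|a 3| + |a 1|) := by
    refine (norm_add_le _ _).trans (add_le_add ?_ ?_)
    · refine (norm_sub_le _ _).trans ?_
      simp
    · rw [norm_mul, Complex.norm_I, mul_one]
      refine (norm_sub_le _ _).trans ?_
      simp
  have h5 := h1 0
  have h6 := h1 1
  have h7 := h1 2
  have h8 := h1 3
  simp only [Fin.isValue, Fin.val_zero, Fin.val_one,
      show ((2 : Fin 4) : ℕ) = 2 from rfl, show ((3 : Fin 4) : ℕ) = 3 from rfl] at h5 h6 h7 h8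
  have h9 : |a 0| + |a 2| + (|a 3| + |a 1|) ≤ 8 * δ * d := by
    calc _ ≤ δ * d * ((‖x + Complex.I ^ (0 : ℕ) • y‖ ^ 2 + ‖x + Complex.I ^ (2 : ℕ) • y‖ ^ 2) +
          (‖x + Complex.I ^ (1 : ℕ) • y‖ ^ 2 + ‖x + Complex.I ^ (3 : ℕ) • y‖ ^ 2)) := by
            linarith
      _ = _ := by rw [h3.1, h3.2]; ring
  rw [show ‖(4 : ℂ)‖ = 4 by simp, div_le_iff₀ (by norm_num)]
  linarith

/-- A decomposition of a matrix into projections on lines, with nonnegative weights. -/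
structure IsMixture {D : ℕ} (A : Matrix (Fin D) (Fin D) ℂ) (p : Fin D → ℝ)
    (ψ : Fin D → EuclideanSpace ℂ (Fin D)) : Prop where
  nonneg : ∀ i, 0 ≤ p i
  norm_eq : ∀ i, ‖ψ i‖ = 1
  eq_sum : A = ∑ i, (p i : ℂ) • vecMulVec (ψ i) (star (ψ i).ofLp)

/-- Eigenvalues and an orthonormal eigenbasis; orthogonality is not recorded, since only unit length
matters later. -/
theorem Matrix.PosSemidef.exists_isMixture {D : ℕ} {A : Matrix (Fin D) (Fin D) ℂ}
    (hA : A.PosSemidef) : ∃ p ψ, IsMixture A p ψ := by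
  refine ⟨hA.isHermitian.eigenvalues, hA.isHermitian.eigenvectorBasis, hA.eigenvalues_nonneg,
    fun i => hA.isHermitian.eigenvectorBasis.orthonormal.1 i, ?_⟩
  conv_lhs => rw [hA.isHermitian.spectral_theorem]
  ext a b
  rw [Unitary.conjStarAlgAut_apply, Matrix.sum_apply, Matrix.mul_apply]
  refine Finset.sum_congr rfl fun i _ => ?_
  rw [Matrix.mul_diagonal, Matrix.star_apply, hA.isHermitian.eigenvectorUnitary_apply,
    hA.isHermitian.eigenvectorUnitary_apply, Matrix.smul_apply, vecMulVec_apply]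
  simp
  ring

namespace IsMixture

variable {d D : ℕ} {A B : Matrix (Fin D) (Fin D) ℂ} {p q : Fin D → ℝ}
  {ψ φ : Fin D → EuclideanSpace ℂ (Fin D)}

theorem trace_vecMulVec_mul {n : ℕ} (x y : EuclideanSpace ℂ (Fin n)) :
    (vecMulVec x.ofLp (star x.ofLp) * vecMulVec y.ofLp (star y.ofLp)).trace =
      ((‖inner ℂ x y‖ ^ 2 : ℝ) : ℂ) := by
  rw [vecMulVec_mul_vecMulVec, trace_vecMulVec, dotProduct_smul, smul_eq_mul]
  have h1 : star x.ofLp ⬝ᵥ y.ofLp = inner ℂ x y := by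
    rw [EuclideanSpace.inner_eq_star_dotProduct, dotProduct_comm]
  have h2 : x.ofLp ⬝ᵥ star y.ofLp = inner ℂ y x := by
    rw [EuclideanSpace.inner_eq_star_dotProduct]
  rw [h1, h2, ← inner_conj_symm y x, Complex.mul_conj, Complex.normSq_eq_norm_sq]

theorem conj_eq_sum (h : IsMixture A p ψ) (M : Matrix (Fin d) (Fin D) ℂ) :
    M * A * Mᴴ = ∑ i, (p i : ℂ) •
      vecMulVec (toEuclideanLin M (ψ i)).ofLp (star (toEuclideanLin M (ψ i)).ofLp) := by
  rw [h.eq_sum, Matrix.mul_sum, Matrix.sum_mul]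
  refine Finset.sum_congr rfl fun i _ => ?_
  rw [Matrix.mul_smul, Matrix.smul_mul, mul_vecMulVec, vecMulVec_mul, ofLp_toLpLin, toLin'_apply,
    star_mulVec]

theorem trace_conj (h : IsMixture A p ψ) (M : Matrix (Fin d) (Fin D) ℂ) :
    (M * A * Mᴴ).trace = ((∑ i, p i * ‖toEuclideanLin M (ψ i)‖ ^ 2 : ℝ) : ℂ) := by
  rw [h.conj_eq_sum, trace_sum, Complex.ofReal_sum]
  refine Finset.sum_congr rfl fun i _ => ?_
  rw [trace_smul, trace_vecMulVec, ← EuclideanSpace.inner_eq_star_dotProduct,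
    inner_self_eq_norm_sq_to_K]
  simp

theorem trace_conj_mul_conj (hA : IsMixture A p ψ) (hB : IsMixture B q φ)
    (M : Matrix (Fin d) (Fin D) ℂ) : (M * A * Mᴴ * (M * B * Mᴴ)).trace =
      ((∑ i, ∑ j, p i * q j * ‖inner ℂ (toEuclideanLin M (ψ i)) (toEuclideanLin M (φ j))‖ ^ 2 : ℝ)
        : ℂ) := by
  rw [hA.conj_eq_sum, hB.conj_eq_sum, Finset.sum_mul_sum, trace_sum, Complex.ofReal_sum]
  refine Finset.sum_congr rfl fun i _ => ?_
  rw [trace_sum, Complex.ofReal_sum]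
  refine Finset.sum_congr rfl fun j _ => ?_
  rw [Matrix.smul_mul, Matrix.mul_smul, trace_smul, trace_smul, trace_vecMulVec_mul]
  simp
  ring

theorem trace_eq (h : IsMixture A p ψ) : A.trace = ((∑ i, p i : ℝ) : ℂ) := by
  have := h.trace_conj (1 : Matrix (Fin D) (Fin D) ℂ)
  simpa [h.norm_eq, toEuclideanLin] using this

theorem trace_mul (hA : IsMixture A p ψ) (hB : IsMixture B q φ) : (A * B).trace =
      ((∑ i, ∑ j, p i * q j * ‖inner ℂ (ψ i) (φ j)‖ ^ 2 : ℝ) : ℂ) := by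
  have := hA.trace_conj_mul_conj hB (1 : Matrix (Fin D) (Fin D) ℂ)
  simpa [toEuclideanLin] using this

end IsMixture

/-- The source of the constant `200`. The normalization `c = τ (1 + 8 ε)` satisfies `|1 - c| ≤ 13 ε`
and `c ≥ 1 / 2`, so the error is at most `2 (6 + 13) ε T`. -/
theorem abs_div_sub_le {ε τ u v T : ℝ} (h0 : 0 < ε) (h1 : ε ≤ 1 / 2) (hτ : |τ - 1| ≤ ε)
    (hv : 0 ≤ v) (hvT : v ≤ T) (huv : |u - v| ≤ 6 * ε * T) :
    |u / (τ * (1 + 8 * ε)) - v| ≤ 200 * ε * T := by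
  have h2 := abs_le.1 hτ
  have hT : 0 ≤ T := hv.trans hvT
  have hc : 1 / 2 ≤ τ * (1 + 8 * ε) := by nlinarith
  have hc0 : 0 < τ * (1 + 8 * ε) := by linarith
  rw [show u / (τ * (1 + 8 * ε)) - v = ((u - v) + v * (1 - τ * (1 + 8 * ε))) / (τ * (1 + 8 * ε)) by
    generalize τ * (1 + 8 * ε) = c at hc0; field_simp; ring, abs_div, abs_of_pos hc0,
      div_le_iff₀ hc0]
  have h3 : |1 - τ * (1 + 8 * ε)| ≤ 13 * ε := by rw [abs_le]; constructor <;> nlinarith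
  have h4 : |(u - v) + v * (1 - τ * (1 + 8 * ε))| ≤ 6 * ε * T + T * (13 * ε) := by
    refine (abs_add_le _ _).trans (add_le_add huv ?_)
    rw [abs_mul, abs_of_nonneg hv]
    exact mul_le_mul hvT h3 (abs_nonneg _) hT
  have : 0 ≤ ε * T := by positivity
  nlinarith

/-- The normalized image of a state. -/
noncomputable def sketchState {d D : ℕ} (G : Fin d → Fin D → ℝ) (ρ : Matrix (Fin D) (Fin D) ℂ) :
    Matrix (Fin d) (Fin d) ℂ :=
  (complexMatrix G * ρ * (complexMatrix G)ᴴ).trace⁻¹ •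
    (complexMatrix G * ρ * (complexMatrix G)ᴴ)

/-- The rescaled image of a measurement operator. -/
noncomputable def sketchEffect {d D : ℕ} (G : Fin d → Fin D → ℝ) (ε : ℝ)
    (E : Matrix (Fin D) (Fin D) ℂ) : Matrix (Fin d) (Fin d) ℂ :=
  ((d * (1 + 8 * ε) : ℝ) : ℂ)⁻¹ • (complexMatrix G * E * (complexMatrix G)ᴴ)

/-- Difference of squares: `‖a‖ ≤ 2`, so `‖a‖ + ‖b‖ ≤ 3`. -/
theorem abs_normSq_sub_normSq_le {a b : ℂ} {δ : ℝ} (hb : ‖b‖ ≤ 1) (hab : ‖a - b‖ ≤ 2 * δ)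
    (h1 : δ ≤ 1 / 2) : |‖a‖ ^ 2 - ‖b‖ ^ 2| ≤ 6 * δ := by
  have h2 := abs_norm_sub_norm_le a b
  have h3 : ‖a‖ ≤ ‖a - b‖ + ‖b‖ := by simpa using norm_add_le (a - b) b
  rw [sq_sub_sq, abs_mul, abs_of_nonneg (by positivity : 0 ≤ ‖a‖ + ‖b‖)]
  calc _ ≤ 3 * (2 * δ) := mul_le_mul (by linarith) (h2.trans hab) (abs_nonneg _) (by norm_num)
    _ = _ := by ring

section Approximation

variable {d D : ℕ} {G : Fin d → Fin D → ℝ} {ε : ℝ} {ρ E : Matrix (Fin D) (Fin D) ℂ}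
  {p q : Fin D → ℝ} {ψ φ : Fin D → EuclideanSpace ℂ (Fin D)}

theorem abs_trace_conj_sub_le (hd : 0 < d) (hρ : IsMixture ρ p ψ) (hp : ∑ i, p i = 1)
    (hG : ∀ i, AlmostPreserves G ε (ψ i)) :
    |(∑ i, p i * ‖toEuclideanLin (complexMatrix G) (ψ i)‖ ^ 2) / d - 1| ≤ ε := by
  have hd' : (0 : ℝ) < d := Nat.cast_pos.2 hd
  have h1 : ∀ i, |p i * ‖toEuclideanLin (complexMatrix G) (ψ i)‖ ^ 2 - p i * d| ≤
      p i * (ε * d) := by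
    intro i
    rw [← mul_sub, abs_mul, abs_of_nonneg (hρ.nonneg i)]
    have := hG i
    rw [AlmostPreserves, hρ.norm_eq, one_pow, mul_one] at this
    exact mul_le_mul_of_nonneg_left this (hρ.nonneg i)
  have h2 : |∑ i, p i * ‖toEuclideanLin (complexMatrix G) (ψ i)‖ ^ 2 - d| ≤ ε * d := by
    calc _ = |∑ i, (p i * ‖toEuclideanLin (complexMatrix G) (ψ i)‖ ^ 2 - p i * d)| := by
          rw [Finset.sum_sub_distrib, ← Finset.sum_mul, hp, one_mul]
      _ ≤ ∑ i, p i * (ε * d) :=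
          (Finset.abs_sum_le_sum_abs _ _).trans (Finset.sum_le_sum fun i _ => h1 i)
      _ = _ := by rw [← Finset.sum_mul, hp, one_mul]
  rw [div_sub_one hd'.ne', abs_div, abs_of_pos hd', div_le_iff₀ hd']
  exact h2

/-- Both traces are sums of squared inner products with the same weights `p i * q j`. Each squared
inner product, divided by `d ^ 2`, is off by at most `6 ε`, and the weights add up to `tr E` because
the `p i` add up to one. The normalizations of state and effect are accounted for by
`abs_div_sub_le`. -/
theorem sketch_approximates (hd : 0 < d) (h0 : 0 < ε) (h1 : ε ≤ 1 / 2) (hρ : IsMixture ρ p ψ)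
    (hE : IsMixture E q φ) (hp : ∑ i, p i = 1) (hG : ∀ i, AlmostPreserves G ε (ψ i))
    (hG' : ∀ i j, ∀ k : Fin 4, AlmostPreserves G ε (ψ i + Complex.I ^ (k : ℕ) • φ j)) :
    ‖(sketchState G ρ * sketchEffect G ε E).trace - (ρ * E).trace‖ ≤ 200 * ε * E.trace.re := by
  have hd' : (0 : ℝ) < d := Nat.cast_pos.2 hd
  set T := toEuclideanLin (complexMatrix G) with hT
  have hinner : ∀ i j, ‖inner ℂ (ψ i) (φ j)‖ ≤ 1 := fun i j => by
    simpa [hρ.norm_eq, hE.norm_eq] using norm_inner_le_norm (𝕜 := ℂ) (ψ i) (φ j)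
  have hterm : ∀ i j, |‖inner ℂ (T (ψ i)) (T (φ j))‖ ^ 2 / d ^ 2 - ‖inner ℂ (ψ i) (φ j)‖ ^ 2| ≤
      6 * ε := by
    intro i j
    have := inner_almost_preserved (hρ.norm_eq i) (hE.norm_eq j) (hG' i j)
    rw [← div_pow, show ‖inner ℂ (T (ψ i)) (T (φ j))‖ / (d : ℝ) =
      ‖inner ℂ (T (ψ i)) (T (φ j)) / (d : ℂ)‖ by simp]
    refine abs_normSq_sub_normSq_le (hinner i j) ?_ h1
    have hdc : (d : ℂ) ≠ 0 := by exact_mod_cast hd.ne'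
    rw [div_sub' hdc, norm_div, Complex.norm_natCast, div_le_iff₀ hd']
    exact this
  have hw : ∀ i j, 0 ≤ p i * q j := fun i j => mul_nonneg (hρ.nonneg i) (hE.nonneg j)
  have hsum : ∑ i, ∑ j, p i * q j = ∑ j, q j := by
    rw [← Finset.sum_mul_sum, hp, one_mul]
  have huv : |(∑ i, ∑ j, p i * q j * ‖inner ℂ (T (ψ i)) (T (φ j))‖ ^ 2) / d ^ 2 -
      ∑ i, ∑ j, p i * q j * ‖inner ℂ (ψ i) (φ j)‖ ^ 2| ≤ 6 * ε * ∑ j, q j := by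
    rw [← hsum, Finset.sum_div, ← Finset.sum_sub_distrib, Finset.mul_sum]
    refine (Finset.abs_sum_le_sum_abs _ _).trans (Finset.sum_le_sum fun i _ => ?_)
    rw [Finset.sum_div, ← Finset.sum_sub_distrib, Finset.mul_sum]
    refine (Finset.abs_sum_le_sum_abs _ _).trans (Finset.sum_le_sum fun j _ => ?_)
    rw [mul_div_assoc, ← mul_sub, abs_mul, abs_of_nonneg (hw i j), mul_comm]
    exact mul_le_mul_of_nonneg_right (hterm i j) (hw i j)
  have hv : 0 ≤ ∑ i, ∑ j, p i * q j * ‖inner ℂ (ψ i) (φ j)‖ ^ 2 :=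
    Finset.sum_nonneg fun i _ => Finset.sum_nonneg fun j _ => mul_nonneg (hw i j) (sq_nonneg _)
  have hvT : ∑ i, ∑ j, p i * q j * ‖inner ℂ (ψ i) (φ j)‖ ^ 2 ≤ ∑ j, q j := by
    rw [← hsum]
    refine Finset.sum_le_sum fun i _ => Finset.sum_le_sum fun j _ => ?_
    exact mul_le_of_le_one_right (hw i j) (pow_le_one₀ (norm_nonneg _) (hinner i j))
  have key := abs_div_sub_le h0 h1 (abs_trace_conj_sub_le hd hρ hp hG) hv hvT huv
  rw [sketchState, sketchEffect, Matrix.smul_mul, Matrix.mul_smul, trace_smul, trace_smul,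
    hρ.trace_conj_mul_conj hE, hρ.trace_conj, hρ.trace_mul hE, hE.trace_eq]
  rw [smul_eq_mul, smul_eq_mul, ← Complex.ofReal_inv, ← Complex.ofReal_inv, ← Complex.ofReal_mul,
    ← Complex.ofReal_mul, ← Complex.ofReal_sub, Complex.norm_real, Real.norm_eq_abs,
    Complex.ofReal_re]
  convert key using 3
  field_simp
  rfl

theorem isState_sketchState (hd : 0 < d) (h1 : ε ≤ 1 / 2) (hρ' : IsState ρ)
    (hρ : IsMixture ρ p ψ) (hp : ∑ i, p i = 1) (hG : ∀ i, AlmostPreserves G ε (ψ i)) :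
    IsState (sketchState G ρ) := by
  have hpos : (complexMatrix G * ρ * (complexMatrix G)ᴴ).PosSemidef :=
    hρ'.1.mul_mul_conjTranspose_same _
  -- A zero trace would be at distance `1 > ε` from its ideal value after division by `d`.
  have hne : (complexMatrix G * ρ * (complexMatrix G)ᴴ).trace ≠ 0 := by
    intro h0
    have key := abs_trace_conj_sub_le hd hρ hp hG
    rw [hρ.trace_conj, Complex.ofReal_eq_zero] at h0
    rw [h0] at key
    norm_num at key
    linarith
  refine ⟨hpos.smul ?_, ?_⟩
  · exact inv_nonneg.2 hpos.trace_nonneg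
  · rw [sketchState, trace_smul, smul_eq_mul, inv_mul_cancel₀ hne]

end Approximation

/-- If `G / √d` is not too expansive on the range of `S`, where `0 ≤ S ≤ 1`, then the rescaled
image of `S` is at most one. -/
theorem posSemidef_one_sub_sketchEffect {d D : ℕ} {G : Fin d → Fin D → ℝ} {ε : ℝ} (hd : 0 < d)
    (h0 : 0 < ε) {S : Matrix (Fin D) (Fin D) ℂ} (hS : S.PosSemidef) (hS' : (1 - S).PosSemidef)
    (hG : ∀ w ∈ LinearMap.range (toEuclideanLin S), AlmostPreserves G (8 * ε) w) :
    (1 - sketchEffect G ε S).PosSemidef := by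
  have hd' : (0 : ℝ) < d := Nat.cast_pos.2 hd
  set M := complexMatrix G with hM
  set c : ℝ := d * (1 + 8 * ε) with hc
  have hc0 : 0 < c := by positivity
  -- `S - S² = S (1 - S) S + (1 - S) S (1 - S)`.
  have hsq : (S - S * S).PosSemidef := by
    have h1 := (hS'.conjTranspose_mul_mul_same S).add (hS.conjTranspose_mul_mul_same (1 - S))
    rw [hS.isHermitian.eq, hS'.isHermitian.eq] at h1
    convert h1 using 1
    noncomm_ring
  have hpos : (M * S * Mᴴ).PosSemidef := hS.mul_mul_conjTranspose_same M
  have hherm : (1 - sketchEffect G ε S).IsHermitian :=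
    Matrix.isHermitian_one.sub (hpos.smul (a := (c : ℂ)⁻¹)
      (inv_nonneg.2 (by exact_mod_cast hc0.le))).isHermitian
  refine .of_dotProduct_mulVec_nonneg hherm fun φ => ?_
  -- Put `r = ⟨w, S w⟩ = ⟨φ, M v⟩` with `v = S w`, a vector in the range of `S`. Then `‖M v‖² ≤ c
  -- ‖v‖² ≤ c r` since `S² ≤ S`, and Cauchy–Schwarz gives `r² ≤ ‖φ‖² c r`. Thus `r ≤ c ‖φ‖²` without
  -- a square root of `S`.
  set w := Mᴴ *ᵥ φ with hw
  set v := S *ᵥ w with hv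
  obtain ⟨r, hr0, hr⟩ : ∃ r : ℝ, 0 ≤ r ∧ star w ⬝ᵥ v = r := by
    have := Complex.nonneg_iff.1 (hS.dotProduct_mulVec_nonneg w)
    exact ⟨(star w ⬝ᵥ v).re, this.1, Complex.ext rfl this.2.symm⟩
  have hφ : star φ ⬝ᵥ φ = ((‖WithLp.toLp 2 φ‖ ^ 2 : ℝ) : ℂ) := by
    rw [dotProduct_comm, ← EuclideanSpace.inner_toLp_toLp, inner_self_eq_norm_sq_to_K]
    simp
  have hvv : star v ⬝ᵥ v = ((‖WithLp.toLp 2 v‖ ^ 2 : ℝ) : ℂ) := by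
    rw [dotProduct_comm, ← EuclideanSpace.inner_toLp_toLp, inner_self_eq_norm_sq_to_K]
    simp
  have hMv : star φ ⬝ᵥ (M *ᵥ v) = r := by
    rw [← hr, hw, star_mulVec, conjTranspose_conjTranspose, dotProduct_mulVec]
  have hvr : ‖WithLp.toLp 2 v‖ ^ 2 ≤ r := by
    have h1 := hsq.dotProduct_mulVec_nonneg w
    rw [sub_mulVec, dotProduct_sub, ← mulVec_mulVec] at h1
    have h2 : star w ⬝ᵥ (S *ᵥ (S *ᵥ w)) = star v ⬝ᵥ v := by
      rw [hv, star_mulVec S w, hS.isHermitian.eq, ← dotProduct_mulVec]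
    rw [h2, ← hv, hvv, hr, ← Complex.ofReal_sub, Complex.zero_le_real] at h1
    linarith
  have hT : ‖toEuclideanLin M (WithLp.toLp 2 v)‖ ^ 2 ≤ c * r := by
    have h1 := (abs_le.1 (hG (WithLp.toLp 2 v) ⟨WithLp.toLp 2 w, rfl⟩)).2
    calc _ ≤ c * ‖WithLp.toLp 2 v‖ ^ 2 := by rw [hc]; linarith
      _ ≤ _ := mul_le_mul_of_nonneg_left hvr hc0.le
  have hcs : r ≤ ‖WithLp.toLp 2 φ‖ * ‖toEuclideanLin M (WithLp.toLp 2 v)‖ := by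
    have h1 := norm_inner_le_norm (𝕜 := ℂ) (WithLp.toLp 2 φ) (toEuclideanLin M (WithLp.toLp 2 v))
    have h2 : inner ℂ (WithLp.toLp 2 φ) (toEuclideanLin M (WithLp.toLp 2 v)) = (r : ℂ) := by
      rw [toLpLin_toLp, toLin'_apply, EuclideanSpace.inner_toLp_toLp, dotProduct_comm]
      exact hMv
    rw [h2, Complex.norm_real, Real.norm_of_nonneg hr0] at h1
    exact h1
  have hfin : r ≤ c * ‖WithLp.toLp 2 φ‖ ^ 2 := by
    rcases hr0.eq_or_lt with h | h
    · rw [← h]; positivity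
    · have h1 : r ^ 2 ≤ ‖WithLp.toLp 2 φ‖ ^ 2 * (c * r) := by
        calc r ^ 2 ≤ (‖WithLp.toLp 2 φ‖ * ‖toEuclideanLin M (WithLp.toLp 2 v)‖) ^ 2 :=
              pow_le_pow_left₀ hr0 hcs 2
          _ ≤ _ := by rw [mul_pow]; exact mul_le_mul_of_nonneg_left hT (sq_nonneg _)
      have h2 : r * r ≤ r * (c * ‖WithLp.toLp 2 φ‖ ^ 2) := by linarith
      exact le_of_mul_le_mul_left h2 h
  rw [sub_mulVec, one_mulVec, dotProduct_sub, hφ, sketchEffect, smul_mulVec, dotProduct_smul,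
    ← mulVec_mulVec, ← mulVec_mulVec, ← hM, ← hw, ← hv, hMv, smul_eq_mul, ← hc,
    ← Complex.ofReal_inv, ← Complex.ofReal_mul, ← Complex.ofReal_sub, Complex.zero_le_real,
    sub_nonneg, inv_mul_le_iff₀ hc0]
  exact hfin

end Sketch

/-! ### Union bound over all vectors to be preserved -/

section GoodSketch

open MeasureTheory Matrix

theorem measure_not_forall_le {α ι : Type*} [Fintype ι] {_ : MeasurableSpace α} (μ : Measure α)
    (p : ι → α → Prop) {b : ENNReal} (h : ∀ i, μ {a | ¬ p i a} ≤ b) :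
    μ {a | ¬ ∀ i, p i a} ≤ Fintype.card ι * b := by
  have : {a | ¬ ∀ i, p i a} = ⋃ i, {a | ¬ p i a} := by
    ext a; simp
  rw [this]
  refine (measure_iUnion_fintype_le μ _).trans
    ((Finset.sum_le_card_nsmul _ _ _ fun i _ => h i).trans ?_)
  rw [nsmul_eq_mul, Finset.card_univ]

theorem Matrix.finrank_range_toEuclideanLin {D : ℕ} (S : Matrix (Fin D) (Fin D) ℂ) :
    Module.finrank ℂ (LinearMap.range (toEuclideanLin S)) = S.rank := by
  rw [show toEuclideanLin S = toLpLin 2 2 S from rfl, toLpLin_eq_toLin,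
    ← rank_eq_finrank_range_toLin]

/-- The net depends on `S` only, so the union bound runs over a fixed finite set of size at most
`625 ^ S.rank`; the net argument then costs the factor `4`. -/
theorem gaussianMatrix_range_le {d D : ℕ} (hd : 0 < d) (S : Matrix (Fin D) (Fin D) ℂ) {δ : ℝ}
    (h0 : 0 ≤ δ) (h1 : δ ≤ 1) :
    gaussianMatrix d D {G | ¬ ∀ w ∈ LinearMap.range (toEuclideanLin S),
      AlmostPreserves G (4 * δ) w} ≤
      ENNReal.ofReal (625 ^ S.rank * (4 * Real.exp (-(d * δ ^ 2 / 8)))) := by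
  have hd' : (0 : ℝ) < d := Nat.cast_pos.2 hd
  obtain ⟨N, hN, hnet⟩ := exists_net_almost_isometry (F := EuclideanSpace ℂ (Fin d))
    (LinearMap.range (toEuclideanLin S))
  rw [finrank_range_toEuclideanLin] at hN
  have hsub : {G : Fin d → Fin D → ℝ | ¬ ∀ w ∈ LinearMap.range (toEuclideanLin S),
      AlmostPreserves G (4 * δ) w} ⊆ {G | ¬ ∀ w : N, AlmostPreserves G δ (w : _).1} := by
    intro G hG hcon
    refine hG fun w hw => ?_
    have hnorm : ∀ v, ‖(((Real.sqrt d)⁻¹ : ℝ) : ℂ) • toEuclideanLin (complexMatrix G) v‖ ^ 2 =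
        ‖toEuclideanLin (complexMatrix G) v‖ ^ 2 / d := by
      intro v
      rw [norm_smul, mul_pow, Complex.norm_real, norm_inv, inv_pow, Real.norm_eq_abs, sq_abs,
        Real.sq_sqrt hd'.le]
      field_simp
    have hiff : ∀ δ v, AlmostPreserves G δ v ↔
        |‖(((Real.sqrt d)⁻¹ : ℝ) : ℂ) • toEuclideanLin (complexMatrix G) v‖ ^ 2 - ‖v‖ ^ 2| ≤
          δ * ‖v‖ ^ 2 := by
      intro δ v
      rw [hnorm, div_sub' hd'.ne', abs_div, abs_of_pos hd', div_le_iff₀ hd', AlmostPreserves,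
        show δ * ‖v‖ ^ 2 * d = δ * (d * ‖v‖ ^ 2) by ring]
    have := hnet ((((Real.sqrt d)⁻¹ : ℝ) : ℂ) •
      (toEuclideanLin (complexMatrix G)).comp (Submodule.subtype _)) δ
      (fun y hy => (hiff _ _).1 (hcon ⟨y, hy⟩)) h0 ⟨w, hw⟩
    exact (hiff _ _).2 this
  refine (measure_mono hsub).trans ((measure_not_forall_le _ _ fun w =>
    gaussianMatrix_almostPreserves _ h0 h1).trans ?_)
  rw [ENNReal.ofReal_mul (p := 625 ^ S.rank) (by positivity), Fintype.card_coe]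
  refine mul_le_mul_left ?_ _
  rw [← ENNReal.ofReal_natCast]
  exact ENNReal.ofReal_le_ofReal (by exact_mod_cast hN)

/-- The properties of `G` that make the compressed model approximate the given one. -/
structure GoodSketch {X Y Z D d : ℕ} (G : Fin d → Fin D → ℝ) (ε : ℝ)
    (ψ : Fin X → Fin D → EuclideanSpace ℂ (Fin D))
    (φ : Fin Y → Fin Z → Fin D → EuclideanSpace ℂ (Fin D))
    (S : Fin Y → Matrix (Fin D) (Fin D) ℂ) : Prop where
  state : ∀ x i, AlmostPreserves G ε (ψ x i)
  pair : ∀ x y z i j, ∀ k : Fin 4, AlmostPreserves G ε (ψ x i + Complex.I ^ (k : ℕ) • φ y z j)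
  range : ∀ y, ∀ w ∈ LinearMap.range (toEuclideanLin (S y)), AlmostPreserves G (8 * ε) w

/-- With `u = 4 J D`, `h1` says `t = exp (-d ε² / 8) ≤ u⁻⁴`. There are at most `u² / 8` vectors with
failure probability `4 t`, and each of the `Y ≤ u` nets, of size at most `R`, fails with probability
at most `4 t²`. -/
theorem union_bound_le {X Y Z D d : ℕ} {ε R : ℝ} (hZ : 0 < Z) (hD : 0 < D)
    (h1 : 32 * Real.log (4 * ((X + Y * Z : ℕ) : ℝ) * (D : ℝ)) ≤ d * ε ^ 2)
    (hR : R ≤ Real.exp (d * ε ^ 2 / 4)) (hR0 : 0 ≤ R) :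
    (X * D + X * Y * Z * D * D * 4 : ℝ) * (4 * Real.exp (-(d * ε ^ 2 / 8))) +
      Y * (R * (4 * Real.exp (-(d * (2 * ε) ^ 2 / 8)))) ≤ 1 / 3 := by
  -- For `X = Y = 0` the hypothesis `h1` is void because `Real.log 0 = 0`, but there is nothing to
  -- preserve either.
  rcases Nat.eq_zero_or_pos (X + Y) with hXY | hXY
  · have hX : X = 0 := by omega
    have hY : Y = 0 := by omega
    subst hX hY
    norm_num
  have hZ1 : (1 : ℝ) ≤ Z := by exact_mod_cast hZ
  have hD1 : (1 : ℝ) ≤ D := by exact_mod_cast hD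
  have hX0 : (0 : ℝ) ≤ X := Nat.cast_nonneg _
  have hY0 : (0 : ℝ) ≤ Y := Nat.cast_nonneg _
  have hXY1 : (1 : ℝ) ≤ X + Y := by exact_mod_cast hXY
  set J : ℝ := ((X + Y * Z : ℕ) : ℝ) with hJ
  have hJeq : J = X + Y * Z := by rw [hJ]; push_cast; ring
  have hYJ : (Y : ℝ) ≤ Y * Z := le_mul_of_one_le_right hY0 hZ1
  have hJ1 : 1 ≤ J := by rw [hJeq]; linarith
  set u : ℝ := 4 * J * D with hu
  have hu4 : 4 ≤ u := by rw [hu]; nlinarith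
  have hu0 : 0 < u := by linarith
  set t := Real.exp (-(d * ε ^ 2 / 8)) with ht
  have ht0 : 0 < t := Real.exp_pos _
  have htu : t ≤ (u ^ 4)⁻¹ := by
    rw [ht, Real.exp_neg]
    refine inv_anti₀ (by positivity) ?_
    rw [← Real.exp_log hu0, ← Real.exp_nat_mul]
    exact Real.exp_le_exp.2 (by push_cast; linarith)
  have hcount : (X * D + X * Y * Z * D * D * 4 : ℝ) ≤ u ^ 2 / 8 := by
    have e1 : (X * D : ℝ) ≤ u / 4 := by
      rw [hu]
      have : (X : ℝ) ≤ J := by rw [hJeq]; linarith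
      nlinarith
    -- Arithmetic–geometric mean: `4 X (Y Z) ≤ (X + Y Z)²`.
    have e2 : (X * Y * Z * D * D * 4 : ℝ) ≤ u ^ 2 / 16 := by
      rw [hu, hJeq]
      have : 0 ≤ ((X - Y * Z) * D : ℝ) ^ 2 := sq_nonneg _
      nlinarith
    nlinarith
  have hfirst : (X * D + X * Y * Z * D * D * 4 : ℝ) * (4 * t) ≤ 1 / 32 := by
    calc _ ≤ u ^ 2 / 8 * (4 * (u ^ 4)⁻¹) := by gcongr
      _ = (u ^ 2)⁻¹ / 2 := by field_simp; ring
      _ ≤ (4 ^ 2)⁻¹ / 2 := by gcongr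
      _ = _ := by norm_num
  have hsecond : Y * (R * (4 * Real.exp (-(d * (2 * ε) ^ 2 / 8)))) ≤ 1 / 16 := by
    have e1 : Real.exp (d * ε ^ 2 / 4) * Real.exp (-(d * (2 * ε) ^ 2 / 8)) = t ^ 2 := by
      rw [ht, ← Real.exp_add, ← Real.exp_nat_mul]
      congr 1
      push_cast
      ring
    have e2 : (Y : ℝ) ≤ u := by
      rw [hu]
      have : (Y : ℝ) ≤ J := by rw [hJeq]; linarith
      nlinarith
    have e3 : R * (4 * Real.exp (-(d * (2 * ε) ^ 2 / 8))) ≤ 4 * t ^ 2 := by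
      rw [← e1]
      have := mul_le_mul_of_nonneg_right hR (Real.exp_pos (-(d * (2 * ε) ^ 2 / 8))).le
      linarith
    calc _ ≤ u * (4 * ((u ^ 4)⁻¹) ^ 2) := by
          refine mul_le_mul e2 (e3.trans ?_) (by positivity) hu0.le
          gcongr
      _ = 4 * (u ^ 7)⁻¹ := by field_simp
      _ ≤ 4 * (4 ^ 7)⁻¹ := by gcongr
      _ ≤ _ := by norm_num
  linarith

theorem pow_rank_le_exp {r : ℕ} {t : ℝ} (h : 32 * (r : ℝ) ≤ t) :
    (625 : ℝ) ^ r ≤ Real.exp (t / 4) := by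
  have h1 : (625 : ℝ) ≤ Real.exp 8 := by
    have h2 : (2.5 : ℝ) ≤ Real.exp 1 := by linarith [Real.exp_one_gt_d9]
    calc (625 : ℝ) ≤ 2.5 ^ 8 := by norm_num
      _ ≤ Real.exp 1 ^ 8 := pow_le_pow_left₀ (by norm_num) h2 8
      _ = _ := by rw [← Real.exp_nat_mul]; norm_num
  calc (625 : ℝ) ^ r ≤ Real.exp 8 ^ r := pow_le_pow_left₀ (by norm_num) h1 r
    _ = Real.exp (r * 8) := by rw [← Real.exp_nat_mul]
    _ ≤ _ := Real.exp_le_exp.2 (by linarith)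

theorem gaussianMatrix_goodSketch {X Y Z D d : ℕ} {ε : ℝ} (hZ : 0 < Z) (hD : 0 < D) (hd : 0 < d)
    (h0 : 0 < ε) (hε : ε ≤ 1 / 2) (ψ : Fin X → Fin D → EuclideanSpace ℂ (Fin D))
    (φ : Fin Y → Fin Z → Fin D → EuclideanSpace ℂ (Fin D))
    (S : Fin Y → Matrix (Fin D) (Fin D) ℂ)
    (h1 : 32 * Real.log (4 * ((X + Y * Z : ℕ) : ℝ) * (D : ℝ)) ≤ d * ε ^ 2)
    (h2 : ∀ y, 32 * ((S y).rank : ℝ) ≤ d * ε ^ 2) :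
    gaussianMatrix d D {G | ¬ GoodSketch G ε ψ φ S} ≤ ENNReal.ofReal (1 / 3) := by
  have hsub : {G : Fin d → Fin D → ℝ | ¬ GoodSketch G ε ψ φ S} ⊆
      ({G | ¬ ∀ q : Fin X × Fin D, AlmostPreserves G ε (ψ q.1 q.2)} ∪
      {G | ¬ ∀ q : Fin X × Fin Y × Fin Z × Fin D × Fin D × Fin 4, AlmostPreserves G ε
        (ψ q.1 q.2.2.2.1 + Complex.I ^ (q.2.2.2.2.2 : ℕ) • φ q.2.1 q.2.2.1 q.2.2.2.2.1)}) ∪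
      -- Accuracy `2 ε` on the net becomes `8 ε` on the range; `ε ≤ 1 / 2` keeps `2 ε` within the
      -- scope of the tail bound.
      {G | ¬ ∀ y, ∀ w ∈ LinearMap.range (toEuclideanLin (S y)),
        AlmostPreserves G (4 * (2 * ε)) w} := by
    intro G hG
    by_contra hcon
    simp only [Set.mem_union, Set.mem_ofPred_eq, not_or, not_not] at hcon
    refine hG ⟨fun x i => hcon.1.1 (x, i), fun x y z i j k => hcon.1.2 (x, y, z, i, j, k),
      fun y w hw => ?_⟩
    have := hcon.2 y w hw
    rwa [show 4 * (2 * ε) = 8 * ε by ring] at this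
  have hrange : ∀ y, gaussianMatrix d D {G | ¬ ∀ w ∈ LinearMap.range (toEuclideanLin (S y)),
      AlmostPreserves G (4 * (2 * ε)) w} ≤ ENNReal.ofReal
        (Real.exp (d * ε ^ 2 / 4) * (4 * Real.exp (-(d * (2 * ε) ^ 2 / 8)))) := fun y =>
    (gaussianMatrix_range_le hd (S y) (by linarith) (by linarith)).trans
      (ENNReal.ofReal_le_ofReal (mul_le_mul_of_nonneg_right (pow_rank_le_exp (h2 y))
        (by positivity)))
  refine (measure_mono hsub).trans ((measure_union_le _ _).trans ((add_le_add
    ((measure_union_le _ _).trans (add_le_add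
      (measure_not_forall_le _ _ fun q => gaussianMatrix_almostPreserves _ h0.le (by linarith))
      (measure_not_forall_le _ _ fun q => gaussianMatrix_almostPreserves _ h0.le (by linarith))))
    (measure_not_forall_le _ _ hrange)).trans ?_))
  refine le_trans (le_of_eq ?_) (ENNReal.ofReal_le_ofReal
    (union_bound_le hZ hD h1 le_rfl (Real.exp_pos _).le))
  have key : ∀ (n : ℕ) (r : ℝ), (n : ENNReal) * ENNReal.ofReal r = ENNReal.ofReal (n * r) :=
    fun n r => by rw [ENNReal.ofReal_mul (Nat.cast_nonneg _), ENNReal.ofReal_natCast]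
  rw [key, key, key, ← ENNReal.ofReal_add (by positivity) (by positivity),
    ← ENNReal.ofReal_add (by positivity) (by positivity)]
  congr 1
  simp
  ring

end GoodSketch

/-! ### The compressed model as a whole -/

section Model

open Matrix

/-- The compressed measurements: the images of all effects but the last, and the complement of
their sum. -/
noncomputable def sketchPOVM {d D Z : ℕ} (G : Fin d → Fin D → ℝ) (ε : ℝ)
    (E : Fin Z → Matrix (Fin D) (Fin D) ℂ) (z : Fin Z) : Matrix (Fin d) (Fin d) ℂ :=
  if (z : ℕ) + 1 < Z then sketchEffect G ε (E z) else 1 - sketchEffect G ε (sumButLast E)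

variable {X Y Z D d : ℕ} {ε : ℝ} {G : Fin d → Fin D → ℝ}

theorem sketchEffect_sumButLast (G : Fin d → Fin D → ℝ) (ε : ℝ)
    (E : Fin Z → Matrix (Fin D) (Fin D) ℂ) : sketchEffect G ε (sumButLast E) =
      ∑ z ∈ Finset.univ.filter (fun z : Fin Z => (z : ℕ) + 1 < Z), sketchEffect G ε (E z) := by
  simp only [sketchEffect, sumButLast, Matrix.mul_sum, Matrix.sum_mul, Finset.smul_sum]

theorem filter_not_lt_eq_singleton (z : Fin Z) (hz : (z : ℕ) + 1 = Z) :
    Finset.univ.filter (fun z : Fin Z => ¬ (z : ℕ) + 1 < Z) = {z} := by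
  ext w
  simp only [Finset.mem_filter, Finset.mem_univ, true_and, Finset.mem_singleton, Fin.ext_iff]
  omega

theorem sumButLast_add_last {E : Fin Z → Matrix (Fin D) (Fin D) ℂ} (hE : IsPOVM E) (z : Fin Z)
    (hz : (z : ℕ) + 1 = Z) : sumButLast E + E z = 1 := by
  rw [← hE.2, ← Finset.sum_filter_add_sum_filter_not Finset.univ (fun z : Fin Z => (z : ℕ) + 1 < Z),
    filter_not_lt_eq_singleton z hz, Finset.sum_singleton, sumButLast]

theorem isPOVM_sketchPOVM (hZ : 0 < Z) (hd : 0 < d) (h0 : 0 < ε)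
    {E : Fin Z → Matrix (Fin D) (Fin D) ℂ} (hE : IsPOVM E)
    (hG : ∀ w ∈ LinearMap.range (toEuclideanLin (sumButLast E)), AlmostPreserves G (8 * ε) w) :
    IsPOVM (sketchPOVM G ε E) := by
  have hd' : (0 : ℝ) < d := Nat.cast_pos.2 hd
  set l : Fin Z := ⟨Z - 1, by omega⟩ with hl
  have hlast : (l : ℕ) + 1 = Z := by simp [hl]; omega
  have hS : (sumButLast E).PosSemidef := posSemidef_sum _ fun z _ => hE.1 z
  have hS' : (1 - sumButLast E).PosSemidef := by
    rw [← sumButLast_add_last hE l hlast, add_sub_cancel_left]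
    exact hE.1 l
  have hpos : ∀ z, (sketchEffect G ε (E z)).PosSemidef := fun z =>
    ((hE.1 z).mul_mul_conjTranspose_same _).smul
      (inv_nonneg.2 (Complex.zero_le_real.2 (by positivity)))
  refine ⟨fun z => ?_, ?_⟩
  · rw [sketchPOVM]
    split_ifs
    · exact hpos z
    · exact posSemidef_one_sub_sketchEffect hd h0 hS hS' hG
  · simp only [sketchPOVM]
    rw [Finset.sum_ite, filter_not_lt_eq_singleton l hlast, Finset.sum_singleton,
      ← sketchEffect_sumButLast, add_sub_cancel]

theorem GoodSketch.isQuantumModel_and_approximates (hZ : 0 < Z) (hd : 0 < d) (h0 : 0 < ε)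
    (h1 : ε ≤ 1 / 2) {ρ : Fin X → Matrix (Fin D) (Fin D) ℂ}
    {E : Fin Y → Fin Z → Matrix (Fin D) (Fin D) ℂ} (hM : IsQuantumModel ρ E)
    {p : Fin X → Fin D → ℝ} {ψ : Fin X → Fin D → EuclideanSpace ℂ (Fin D)}
    {q : Fin Y → Fin Z → Fin D → ℝ} {φ : Fin Y → Fin Z → Fin D → EuclideanSpace ℂ (Fin D)}
    (hρ : ∀ x, IsMixture (ρ x) (p x) (ψ x)) (hE : ∀ y z, IsMixture (E y z) (q y z) (φ y z))
    (hG : GoodSketch G ε ψ φ fun y => sumButLast (E y)) :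
    IsQuantumModel (fun x => sketchState G (ρ x)) (fun y => sketchPOVM G ε (E y)) ∧
      Approximates ε ρ E (fun x => sketchState G (ρ x)) (fun y => sketchPOVM G ε (E y)) := by
  have hp : ∀ x, ∑ i, p x i = 1 := fun x => by
    have := (hM.1 x).2
    rw [(hρ x).trace_eq] at this
    exact_mod_cast this
  have hstate : ∀ x, IsState (sketchState G (ρ x)) := fun x =>
    isState_sketchState hd h1 (hM.1 x) (hρ x) (hp x) (hG.state x)
  have happ : ∀ x y z, ‖(sketchState G (ρ x) * sketchEffect G ε (E y z)).trace -
      (ρ x * E y z).trace‖ ≤ 200 * ε * (E y z).trace.re := fun x y z =>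
    sketch_approximates hd h0 h1 (hρ x) (hE y z) (hp x) (hG.state x) (hG.pair x y z)
  refine ⟨⟨hstate, fun y => isPOVM_sketchPOVM hZ hd h0 (hM.2 y) (hG.range y)⟩, fun x y z =>
    ⟨fun hz => ?_, fun hz => ?_⟩⟩
  · simp only [sketchPOVM, if_pos hz]
    exact happ x y z
  · have hlast := sumButLast_add_last (hM.2 y) z hz
    have e1 : sketchPOVM G ε (E y) z = 1 - sketchEffect G ε (sumButLast (E y)) :=
      if_neg (by omega)
    have e2 : E y z = 1 - sumButLast (E y) := eq_sub_of_add_eq' hlast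
    -- Outcome probabilities add up to one before and after compression, so the errors cancel; the
    -- other effects have total trace `tr (1 - E y z)`.
    have e3 : (sketchState G (ρ x) * sketchPOVM G ε (E y) z).trace - (ρ x * E y z).trace =
        -∑ z ∈ Finset.univ.filter (fun z : Fin Z => (z : ℕ) + 1 < Z),
          ((sketchState G (ρ x) * sketchEffect G ε (E y z)).trace - (ρ x * E y z).trace) := by
      rw [e1, e2, Matrix.mul_sub, Matrix.mul_sub, mul_one, mul_one, trace_sub, trace_sub,
        (hstate x).2, (hM.1 x).2, sketchEffect_sumButLast, sumButLast, Matrix.mul_sum,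
        Matrix.mul_sum, trace_sum, trace_sum, Finset.sum_sub_distrib]
      ring
    have e4 : 1 - E y z = sumButLast (E y) := by rw [e2, sub_sub_cancel]
    rw [e3, norm_neg, e4, sumButLast, trace_sum, Complex.re_sum, Finset.mul_sum]
    exact (norm_sum_le _ _).trans (Finset.sum_le_sum fun z _ => happ x y z)

end Model

namespace RealRAM

/-! ### Filling a memory region -/

/-- Run from any memory that agrees with `m₀` below `b`, the statement `S` keeps the cells below
`b`, writes the target values `F` into the cells in `A`, and destroys no correct value. -/
def Stmt.Fills (ω : ℕ → ℝ) (m₀ : ℕ → ℝ) (b : ℕ) (F : ℕ → ℝ) (S : Stmt) (η : Env) (A : Set ℕ) :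
    Prop :=
  ∀ m : (ℕ → ℝ) × ℕ, (∀ a < b, m.1 a = m₀ a) →
    (∀ a < b, (S.run ω η m).1 a = m₀ a) ∧ (∀ a ∈ A, (S.run ω η m).1 a = F a) ∧
      ∀ a, m.1 a = F a → (S.run ω η m).1 a = F a

namespace Stmt

variable {ω m₀ : ℕ → ℝ} {b : ℕ} {F : ℕ → ℝ} {η : Env}

theorem Fills.store {a : IdxExpr} {e : RealExpr} {a' : ℕ} (ha : a.eval η = a') (hb : b ≤ a')
    (he : ∀ m : ℕ → ℝ, (∀ a < b, m a = m₀ a) → e.eval m η = F a') :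
    Fills ω m₀ b F (.store a e) η {a'} := by
  intro m hm
  subst ha
  refine ⟨fun c hc => ?_, fun c hc => ?_, fun c hc => ?_⟩
  · simp only [run]
    rw [Function.update_of_ne (by omega), hm c hc]
  · rw [Set.mem_singleton_iff.1 hc]
    simp only [run, Function.update_self]
    exact he _ hm
  · simp only [run, Function.update_apply]
    split_ifs with h
    · rw [h]; exact he _ hm
    · exact hc

/-- No disjointness of `A` and `A'` is needed: `S'` may write to a cell of `A`, but leaves the
correct value there. -/
theorem Fills.seq {S S' : Stmt} {A A' : Set ℕ} (h : Fills ω m₀ b F S η A)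
    (h' : Fills ω m₀ b F S' η A') : Fills ω m₀ b F (.seq S S') η (A ∪ A') := by
  intro m hm
  obtain ⟨h1, h2, h3⟩ := h m hm
  obtain ⟨h4, h5, h6⟩ := h' _ h1
  refine ⟨h4, ?_, fun a ha => h6 a (h3 a ha)⟩
  rintro a (ha | ha)
  · exact h6 a (h2 a ha)
  · exact h5 a ha

theorem Fills.loop {v : Fin 16} {n : IdxExpr} {S : Stmt} {N : ℕ} {A : ℕ → Set ℕ}
    (hn : n.eval η = N) (h : ∀ k < N, Fills ω m₀ b F S (Function.update η v k) (A k)) :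
    Fills ω m₀ b F (.loop v n S) η {a | ∃ k < N, a ∈ A k} := by
  intro m hm
  simp only [run, hn]
  suffices H : ∀ j ≤ N, ∀ m' : (ℕ → ℝ) × ℕ,
      m' = Nat.rec m (fun k m' => S.run ω (Function.update η v k) m') j →
      (∀ a < b, m'.1 a = m₀ a) ∧ (∀ k < j, ∀ a ∈ A k, m'.1 a = F a) ∧
        ∀ a, m.1 a = F a → m'.1 a = F a by
    obtain ⟨h1, h2, h3⟩ := H N le_rfl _ rfl
    exact ⟨h1, fun a ⟨k, hk, ha⟩ => h2 k hk a ha, h3⟩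
  intro j
  induction j with
  | zero => rintro - m' rfl; exact ⟨hm, by simp, fun a ha => ha⟩
  | succ j ih =>
    rintro hj m' rfl
    obtain ⟨h1, h2, h3⟩ := ih (by omega) _ rfl
    obtain ⟨h4, h5, h6⟩ := h j (by omega) _ h1
    refine ⟨h4, fun k hk a ha => ?_, fun a ha => h6 a (h3 a ha)⟩
    rcases Nat.lt_succ_iff_lt_or_eq.1 hk with hk | rfl
    · exact h6 a (h2 k hk a ha)
    · exact h5 a ha

/-- The sample counter starts at `0` and so coincides with the loop variable: the `k`-th sample goes
to cell `B + k`. -/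
theorem run_for_sample (v : Fin 16) (n : IdxExpr) {e : IdxExpr} {B N : ℕ} (hn : n.eval η = N)
    (he : ∀ k, e.eval (Function.update η v k) = B + k) (m : ℕ → ℝ) :
    ((Stmt.loop v n (.sample e)).run ω η (m, 0)).1 =
      fun a => if B ≤ a ∧ a < B + N then ω (a - B) else m a := by
  simp only [run, hn, he]
  have H : ∀ j, (Nat.rec (m, 0) (fun k m' => (Function.update m'.1 (B + k) (ω m'.2), m'.2 + 1)) j :
      (ℕ → ℝ) × ℕ) = (fun a => if B ≤ a ∧ a < B + j then ω (a - B) else m a, j) := by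
    intro j
    induction j with
    | zero => exact Prod.ext (funext fun a => (if_neg (by omega)).symm) rfl
    | succ j ih =>
      refine (congrArg (fun m' : (ℕ → ℝ) × ℕ =>
        (Function.update m'.1 (B + j) (ω m'.2), m'.2 + 1)) ih).trans ?_
      refine Prod.ext (funext fun a => ?_) rfl
      simp only [Function.update_apply]
      split_ifs <;> first | rfl | omega | (congr 1; omega)
  rw [H]

end Stmt

/-! ### The program -/

/-- The address of a matrix entry: part `c` of entry `(i, j)` of the `n`-th `k × k` block. -/
def cell (base n k i j c : ℕ) : ℕ := base + 2 * ((n * k + i) * k + j) + c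

theorem cell_lt {base J n k i j c : ℕ} (hn : n < J) (hi : i < k) (hj : j < k) (hc : c < 2) :
    cell base n k i j c < base + 2 * (J * k * k) := by
  have h1 : (n + 1) * k ≤ J * k := Nat.mul_le_mul_right _ hn
  have h2 : (n * k + i + 1) * k ≤ J * k * k := Nat.mul_le_mul_right _ (by rw [add_mul] at h1; omega)
  rw [add_mul _ 1] at h2
  unfold cell
  omega

theorem mul_add_lt {n k i a : ℕ} (hi : i < n) (ha : a < k) : i * k + a < n * k := by
  have h1 : (i + 1) * k ≤ n * k := Nat.mul_le_mul_right _ hi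
  rw [add_mul] at h1
  omega

/-- The addresses of the entries of the `n`-th `k × k` block. -/
def matrixCells (base k n : ℕ) : Set ℕ :=
  {a | ∃ i < k, a ∈ {a | ∃ j < k, a ∈ {a | ∃ c < 2, a ∈ ({cell base n k i j c} : Set ℕ)}}}

/-- The inverse of `cell`. -/
theorem exists_cell_function (base k : ℕ) (W : ℕ → ℕ → ℕ → ℕ → ℝ) : ∃ F : ℕ → ℝ,
    ∀ n i j c, i < k → j < k → c < 2 → F (cell base n k i j c) = W n i j c := by
  refine ⟨fun a => W ((a - base) / 2 / k / k) ((a - base) / 2 / k % k) ((a - base) / 2 % k)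
    ((a - base) % 2), fun n i j c hi hj hc => ?_⟩
  have hk : 0 < k := by omega
  have e0 : cell base n k i j c - base = 2 * ((n * k + i) * k + j) + c := by unfold cell; omega
  have e1 : (cell base n k i j c - base) / 2 = (n * k + i) * k + j := by omega
  have e2 : (cell base n k i j c - base) % 2 = c := by omega
  have e3 : ((n * k + i) * k + j) / k = n * k + i := by
    rw [add_comm, Nat.add_mul_div_right _ _ hk, Nat.div_eq_of_lt hj, zero_add]
  have e4 : (n * k + i) / k = n := by
    rw [add_comm, Nat.add_mul_div_right _ _ hk, Nat.div_eq_of_lt hi, zero_add]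
  simp only [e1, e2, e3, e4, Nat.mul_add_mod_self_right, Nat.mod_eq_of_lt hi, Nat.mod_eq_of_lt hj]

namespace Sketch

/-- The expression for `cell`. -/
def cellExpr (base n k i j c : IdxExpr) : IdxExpr :=
  .add (.add base (.mul (.const 2) (.add (.mul (.add (.mul n k) i) k) j))) c

/-- The number of matrices in a model. -/
def countExpr : IdxExpr := .add (.var 0) (.mul (.var 1) (.var 2))

/-- The address of the Gaussian matrix. -/
def gaussExpr : IdxExpr :=
  .add (.const 1) (.mul (.const 2) (.mul (.mul countExpr (.var 3)) (.var 3)))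

/-- The address of the output. -/
def outExpr : IdxExpr := .add gaussExpr (.mul (.var 4) (.var 3))

/-- The address of the scratch cells. -/
def scratchExpr : IdxExpr :=
  .add outExpr (.mul (.const 2) (.mul (.mul countExpr (.var 4)) (.var 4)))

/-- An entry of the product of the Gaussian matrix, the `n`-th input matrix, and the transpose of
the Gaussian matrix. -/
def conjExpr (n i j c : IdxExpr) : RealExpr :=
  .sum 10 (.var 3) (.sum 11 (.var 3) (.op .mul
    (.op .mul (.load (.add gaussExpr (.add (.mul i (.var 3)) (.var 10))))
      (.load (.add gaussExpr (.add (.mul j (.var 3)) (.var 11)))))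
    (.load (cellExpr (.const 1) n (.var 3) (.var 10) (.var 11) c))))

/-- The normalization of the effects. -/
def scaleExpr : RealExpr :=
  .op .mul (.cast (.var 4)) (.op .add (.cast (.const 1))
    (.op .mul (.cast (.const 8)) (.load (.const 0))))

/-- Store the entries of the `n`-th output matrix. -/
def storeMatrix (n : IdxExpr) (e : RealExpr) : Stmt :=
  .loop 7 (.var 4) (.loop 8 (.var 4) (.loop 9 (.const 2)
    (.store (cellExpr outExpr n (.var 4) (.var 7) (.var 8) (.var 9)) e)))

/-- Draw the Gaussian matrix. -/
def drawStmt : Stmt := .loop 12 (.mul (.var 4) (.var 3)) (.sample (.add gaussExpr (.var 12)))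

/-- Compute the states. -/
def statesStmt : Stmt :=
  .loop 5 (.var 0) (storeMatrix (.var 5) (.op .div (conjExpr (.var 5) (.var 7) (.var 8) (.var 9))
    (.sum 12 (.var 4) (conjExpr (.var 5) (.var 12) (.var 12) (.const 0)))))

/-- The position of an effect in the list of matrices. -/
def effectIdx (z : IdxExpr) : IdxExpr := .add (.var 0) (.add (.mul (.var 5) (.var 2)) z)

/-- The expression for an entry of the image of an effect. -/
def effectExpr : RealExpr :=
  .op .div (conjExpr (effectIdx (.var 6)) (.var 7) (.var 8) (.var 9)) scaleExpr

/-- Compute all effects but the last of each measurement. -/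
def effectsStmt : Stmt :=
  .loop 5 (.var 1) (.loop 6 (.sub (.var 2) (.const 1))
    (storeMatrix (effectIdx (.var 6)) effectExpr))

/-- Compute the last effect of each measurement. -/
def lastStmt : Stmt :=
  .loop 5 (.var 1) (storeMatrix (effectIdx (.sub (.var 2) (.const 1)))
    (.op .sub (.cast (.sub (.const 1) (.add (.add (.sub (.var 7) (.var 8))
      (.sub (.var 8) (.var 7))) (.var 9))))
      (.sum 6 (.sub (.var 2) (.const 1)) effectExpr)))

/-- Compute the compressed model. -/
def outputStmt : Stmt := .seq statesStmt (.seq effectsStmt lastStmt)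

/-- Draw the Gaussian matrix and compute the compressed model. -/
def sketchStmt : Stmt := .seq drawStmt outputStmt

/-! ### Addresses and values computed by the program -/

section Values

variable (X Y Z D d : ℕ)

/-- The value of `gaussExpr`. -/
def gaussAddr : ℕ := 1 + 2 * ((X + Y * Z) * D * D)

/-- The value of `outExpr`. -/
def outAddr : ℕ := gaussAddr X Y Z D + d * D

/-- The value of `scratchExpr`. -/
def scratchAddr : ℕ := outAddr X Y Z D d + 2 * ((X + Y * Z) * d * d)

/-- The value of `conjExpr`. -/
noncomputable def conjValue (m : ℕ → ℝ) (n i j c : ℕ) : ℝ :=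
  ∑ a ∈ Finset.range D, ∑ b ∈ Finset.range D, m (gaussAddr X Y Z D + (i * D + a)) *
    m (gaussAddr X Y Z D + (j * D + b)) * m (cell 1 n D a b c)

/-- The value of `effectExpr`. -/
noncomputable def effectValue (m : ℕ → ℝ) (n i j c : ℕ) : ℝ :=
  conjValue X Y Z D m n i j c / (d * (1 + 8 * m 0))

/-- The numbers to be output. -/
noncomputable def outValue (m : ℕ → ℝ) (n i j c : ℕ) : ℝ :=
  if n < X then conjValue X Y Z D m n i j c / ∑ l ∈ Finset.range d, conjValue X Y Z D m n l l 0
  else if (n - X) % Z + 1 < Z then effectValue X Y Z D d m n i j c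
  else ((1 - ((i - j) + (j - i) + c) : ℕ) : ℝ) -
    ∑ z ∈ Finset.range (Z - 1), effectValue X Y Z D d m (X + ((n - X) / Z * Z + z)) i j c

end Values

variable {X Y Z D d : ℕ}

/-- The first five variables hold the input sizes. -/
def HasSizes (η : Env) (X Y Z D d : ℕ) : Prop :=
  η 0 = X ∧ η 1 = Y ∧ η 2 = Z ∧ η 3 = D ∧ η 4 = d

theorem hasSizes_sizeEnv : HasSizes (sizeEnv X Y Z D d) X Y Z D d :=
  ⟨rfl, rfl, rfl, rfl, rfl⟩

theorem HasSizes.update {η : Env} (h : HasSizes η X Y Z D d) {v : Fin 16} (hv : 5 ≤ v) (k : ℕ) :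
    HasSizes (Function.update η v k) X Y Z D d := by
  have hne : ∀ u : Fin 16, u < 5 → u ≠ v := fun u hu => (hu.trans_le hv).ne
  refine ⟨?_, ?_, ?_, ?_, ?_⟩ <;> rw [Function.update_of_ne (hne _ (by decide))]
  exacts [h.1, h.2.1, h.2.2.1, h.2.2.2.1, h.2.2.2.2]

theorem HasSizes.eval_gaussExpr {η : Env} (hη : HasSizes η X Y Z D d)
    : gaussExpr.eval η = gaussAddr X Y Z D := by
  obtain ⟨h0, h1, h2, h3, h4⟩ := hη
  simp [gaussExpr, countExpr, IdxExpr.eval, gaussAddr, h0, h1, h2, h3]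

theorem HasSizes.eval_outExpr {η : Env} (hη : HasSizes η X Y Z D d)
    : outExpr.eval η = outAddr X Y Z D d := by
  rw [outExpr, IdxExpr.eval, hη.eval_gaussExpr]
  simp [IdxExpr.eval, outAddr, hη.2.2.2.1, hη.2.2.2.2]

theorem HasSizes.eval_scratchExpr {η : Env} (hη : HasSizes η X Y Z D d)
    : scratchExpr.eval η = scratchAddr X Y Z D d := by
  rw [scratchExpr, IdxExpr.eval, hη.eval_outExpr]
  obtain ⟨h0, h1, h2, h3, h4⟩ := hη
  simp [countExpr, IdxExpr.eval, scratchAddr, h0, h1, h2, h4]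

/-- The hypothesis `h` ensures that the arguments do not depend on the variables `10` and `11`,
which are bound by the two sums. -/
theorem HasSizes.eval_conjExpr {η : Env} (hη : HasSizes η X Y Z D d)
    {n i j c : IdxExpr} {n' i' j' c' : ℕ}
    (h : ∀ a b, ∀ η', η' = Function.update (Function.update η 10 a) 11 b →
      n.eval η' = n' ∧ i.eval η' = i' ∧ j.eval η' = j' ∧ c.eval η' = c') (m : ℕ → ℝ) :
    (conjExpr n i j c).eval m η = conjValue X Y Z D m n' i' j' c' := by
  rw [conjExpr, RealExpr.eval, conjValue]
  refine Finset.sum_congr (by rw [IdxExpr.eval, hη.2.2.2.1]) fun a _ => ?_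
  have hη₁ := hη.update (v := 10) (by decide) a
  rw [RealExpr.eval]
  refine Finset.sum_congr (by rw [IdxExpr.eval, hη₁.2.2.2.1]) fun b _ => ?_
  have hη₂ := hη₁.update (v := 11) (by decide) b
  obtain ⟨e1, e2, e3, e4⟩ := h a b _ rfl
  simp only [RealExpr.eval, Op.eval, IdxExpr.eval, cellExpr, hη₂.eval_gaussExpr, e1, e2, e3, e4,
    hη₂.2.2.2.1, cell]
  simp

theorem HasSizes.bounded_conjExpr {η : Env} (hη : HasSizes η X Y Z D d)
    {n i j c : IdxExpr} {n' i' j' c' B : ℕ}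
    (h : ∀ a b, ∀ η', η' = Function.update (Function.update η 10 a) 11 b →
      n.eval η' = n' ∧ i.eval η' = i' ∧ j.eval η' = j' ∧ c.eval η' = c')
    (hn : n' < X + Y * Z) (hi : i' < d) (hj : j' < d) (hc : c' < 2)
    (hB : outAddr X Y Z D d ≤ B) : (conjExpr n i j c).Bounded B η := by
  intro a ha b hb
  have hη₁ := hη.update (v := 10) (by decide) a
  have hη₂ := hη₁.update (v := 11) (by decide) b
  obtain ⟨e1, e2, e3, e4⟩ := h a b _ rfl
  rw [IdxExpr.eval, hη.2.2.2.1] at ha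
  rw [IdxExpr.eval, hη₁.2.2.2.1] at hb
  have h1 := mul_add_lt hi ha
  have h2 := mul_add_lt hj hb
  have h3 := cell_lt (base := 1) hn ha hb hc
  simp only [RealExpr.Bounded, IdxExpr.eval, cellExpr, hη₂.eval_gaussExpr, e1, e2, e3, e4,
    hη₂.2.2.2.1]
  simp only [Function.update_self, ne_eq, Fin.reduceEq, not_false_eq_true, Function.update_of_ne]
  unfold outAddr at hB
  unfold cell at h3
  refine ⟨⟨by omega, by omega⟩, ?_⟩
  unfold gaussAddr at hB
  omega

theorem HasSizes.eval_scaleExpr {η : Env} (hη : HasSizes η X Y Z D d)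
    (m : ℕ → ℝ) : scaleExpr.eval m η = d * (1 + 8 * m 0) := by
  simp [scaleExpr, RealExpr.eval, Op.eval, IdxExpr.eval, hη.2.2.2.2]

/-- The stored expression is determined by the cells below the output region, that is, by the input
and `G`; earlier output cannot interfere. -/
theorem HasSizes.fills_storeMatrix {η : Env} (hη : HasSizes η X Y Z D d)
    {ω m₀ F : ℕ → ℝ} {n : IdxExpr} {e : RealExpr} {N : ℕ}
    (h : ∀ i < d, ∀ j < d, ∀ c < 2, ∀ η', η' = Function.update (Function.update
      (Function.update η 7 i) 8 j) 9 c → HasSizes η' X Y Z D d → n.eval η' = N ∧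
      ∀ m : ℕ → ℝ, (∀ a < outAddr X Y Z D d, m a = m₀ a) →
        e.eval m η' = F (cell (outAddr X Y Z D d) N d i j c)) :
    (storeMatrix n e).Fills ω m₀ (outAddr X Y Z D d) F η (matrixCells (outAddr X Y Z D d) d N) := by
  unfold matrixCells
  refine Stmt.Fills.loop hη.2.2.2.2 fun i hi => ?_
  have hη₁ := hη.update (v := 7) (by decide) i
  refine Stmt.Fills.loop hη₁.2.2.2.2 fun j hj => ?_
  have hη₂ := hη₁.update (v := 8) (by decide) j
  refine Stmt.Fills.loop rfl fun c hc => ?_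
  have hη₃ := hη₂.update (v := 9) (by decide) c
  obtain ⟨h1, h2⟩ := h i hi j hj c hc _ rfl hη₃
  refine Stmt.Fills.store ?_ ?_ h2
  · simp only [cellExpr, IdxExpr.eval, hη₃.eval_outExpr, h1, hη₃.2.2.2.2, cell]
    simp
  · unfold cell; omega

theorem HasSizes.bounded_storeMatrix {η : Env} (hη : HasSizes η X Y Z D d)
    {n : IdxExpr} {e : RealExpr} {N : ℕ} (hN : N < X + Y * Z)
    (h : ∀ i < d, ∀ j < d, ∀ c < 2, ∀ η', η' = Function.update (Function.update
      (Function.update η 7 i) 8 j) 9 c → HasSizes η' X Y Z D d → n.eval η' = N ∧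
      e.Bounded (scratchAddr X Y Z D d) η') :
    (storeMatrix n e).Bounded (scratchAddr X Y Z D d) η := by
  intro i hi
  rw [IdxExpr.eval, hη.2.2.2.2] at hi
  have hη₁ := hη.update (v := 7) (by decide) i
  intro j hj
  rw [IdxExpr.eval, hη₁.2.2.2.2] at hj
  have hη₂ := hη₁.update (v := 8) (by decide) j
  intro c hc
  rw [IdxExpr.eval] at hc
  have hη₃ := hη₂.update (v := 9) (by decide) c
  obtain ⟨h1, h2⟩ := h i hi j hj c hc _ rfl hη₃
  refine ⟨?_, h2⟩
  have h3 := cell_lt (base := outAddr X Y Z D d) hN hi hj hc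
  simp only [cellExpr, IdxExpr.eval, hη₃.eval_outExpr, h1, hη₃.2.2.2.2]
  simp only [Function.update_self, ne_eq, Fin.reduceEq, not_false_eq_true, Function.update_of_ne]
  exact h3

theorem effectIdx_lt {y z : ℕ} (hy : y < Y) (hz : z < Z) : X + (y * Z + z) < X + Y * Z := by
  have := mul_add_lt hy hz
  omega

theorem bounded_sketchStmt (hZ : 0 < Z) : sketchStmt.Bounded
    (scratchExpr.eval (sizeEnv X Y Z D d)) (sizeEnv X Y Z D d) := by
  have hη := hasSizes_sizeEnv (X := X) (Y := Y) (Z := Z) (D := D) (d := d)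
  have hout : outAddr X Y Z D d ≤ scratchAddr X Y Z D d := by unfold scratchAddr; omega
  rw [hη.eval_scratchExpr]
  refine ⟨?_, ?_, ?_, ?_⟩
  · intro k hk
    have hη₁ := hη.update (v := 12) (by decide) k
    simp only [IdxExpr.eval, hη.2.2.2.2, hη.2.2.2.1] at hk
    simp only [Stmt.Bounded, IdxExpr.eval, hη₁.eval_gaussExpr, Function.update_self]
    unfold outAddr at hout
    omega
  · intro x hx
    rw [IdxExpr.eval, hη.1] at hx
    refine (hη.update (v := 5) (by decide) x).bounded_storeMatrix (N := x) (by omega) ?_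
    rintro i hi j hj c hc η' rfl hη'
    refine ⟨by simp [IdxExpr.eval], ?_, fun l hl => ?_⟩
    · refine hη'.bounded_conjExpr (n' := x) (i' := i) (j' := j) (c' := c) ?_
        (by omega) hi hj hc hout
      rintro a b η' rfl
      simp [IdxExpr.eval]
    · rw [IdxExpr.eval, hη'.2.2.2.2] at hl
      refine (hη'.update (v := 12) (by decide) l).bounded_conjExpr (n' := x) (i' := l) (j' := l)
        (c' := 0) ?_ (by omega) hl hl (by omega) hout
      rintro a b η' rfl
      simp [IdxExpr.eval]
  · intro y hy
    rw [IdxExpr.eval, hη.2.1] at hy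
    have hη₁ := hη.update (v := 5) (by decide) y
    intro z hz
    simp only [IdxExpr.eval, hη₁.2.2.1] at hz
    refine (hη₁.update (v := 6) (by decide) z).bounded_storeMatrix (N := X + (y * Z + z))
      (effectIdx_lt hy (by omega)) ?_
    rintro i hi j hj c hc η' rfl hη'
    refine ⟨?_, ?_, ?_⟩
    · simp only [effectIdx, IdxExpr.eval, hη'.1, hη'.2.2.1]
      simp
    · refine hη'.bounded_conjExpr (n' := X + (y * Z + z)) (i' := i) (j' := j) (c' := c) ?_
        (effectIdx_lt hy (by omega)) hi hj hc hout
      rintro a b η'' rfl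
      have hη'' := (hη'.update (v := 10) (by decide) a).update (v := 11) (by decide) b
      simp only [effectIdx, IdxExpr.eval, hη''.1, hη''.2.2.1]
      simp
    · simp only [scaleExpr, RealExpr.Bounded, IdxExpr.eval, true_and]
      unfold scratchAddr outAddr gaussAddr
      omega
  · intro y hy
    rw [IdxExpr.eval, hη.2.1] at hy
    have hη₁ := hη.update (v := 5) (by decide) y
    refine hη₁.bounded_storeMatrix (N := X + (y * Z + (Z - 1))) (effectIdx_lt hy (by omega)) ?_
    rintro i hi j hj c hc η' rfl hη'
    refine ⟨?_, trivial, fun z hz => ⟨?_, ?_⟩⟩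
    · simp only [effectIdx, IdxExpr.eval, hη'.1, hη'.2.2.1]
      simp
    · simp only [IdxExpr.eval, hη'.2.2.1] at hz
      refine (hη'.update (v := 6) (by decide) z).bounded_conjExpr (n' := X + (y * Z + z))
        (i' := i) (j' := j) (c' := c) ?_ (effectIdx_lt hy (by omega)) hi hj hc hout
      rintro a b η'' rfl
      have hη'' := ((hη'.update (v := 6) (by decide) z).update (v := 10) (by decide) a).update
        (v := 11) (by decide) b
      simp only [effectIdx, IdxExpr.eval, hη''.1, hη''.2.2.1]
      simp
    · simp only [scaleExpr, RealExpr.Bounded, IdxExpr.eval, true_and]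
      unfold scratchAddr outAddr gaussAddr
      omega

theorem conjValue_congr {m m₀ : ℕ → ℝ} (hm : ∀ a < outAddr X Y Z D d, m a = m₀ a) {n i j c : ℕ}
    (hn : n < X + Y * Z) (hi : i < d) (hj : j < d) (hc : c < 2) :
    conjValue X Y Z D m n i j c = conjValue X Y Z D m₀ n i j c := by
  refine Finset.sum_congr rfl fun a ha => Finset.sum_congr rfl fun b hb => ?_
  have ha := Finset.mem_range.1 ha
  have hb := Finset.mem_range.1 hb
  have h1 := mul_add_lt hi ha
  have h2 := mul_add_lt hj hb
  have h3 := cell_lt (base := 1) hn ha hb hc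
  rw [hm _ (by unfold outAddr; omega), hm _ (by unfold outAddr; omega),
    hm _ (by unfold outAddr gaussAddr; omega)]

theorem fills_outputStmt {ω m₀ F : ℕ → ℝ} (hZ : 0 < Z)
    (hF : ∀ n i j c, i < d → j < d → c < 2 →
      F (cell (outAddr X Y Z D d) n d i j c) = outValue X Y Z D d m₀ n i j c) :
    outputStmt.Fills ω m₀ (outAddr X Y Z D d) F (sizeEnv X Y Z D d)
      {a | ∃ n < X + Y * Z, ∃ i < d, ∃ j < d, ∃ c < 2,
        a = cell (outAddr X Y Z D d) n d i j c} := by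
  have hη := hasSizes_sizeEnv (X := X) (Y := Y) (Z := Z) (D := D) (d := d)
  have hm0 : ∀ m : ℕ → ℝ, (∀ a < outAddr X Y Z D d, m a = m₀ a) → m 0 = m₀ 0 := fun m hm =>
    hm 0 (by unfold outAddr gaussAddr; omega)
  have hdiv : ∀ y z, z < Z → (y * Z + z) / Z = y := fun y z hz => by
    rw [add_comm, Nat.add_mul_div_right _ _ hZ, Nat.div_eq_of_lt hz, zero_add]
  have hstates : statesStmt.Fills ω m₀ (outAddr X Y Z D d) F (sizeEnv X Y Z D d)
      {a | ∃ x < X, a ∈ matrixCells (outAddr X Y Z D d) d x} := by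
    refine Stmt.Fills.loop hη.1 fun x hx => ?_
    refine (hη.update (v := 5) (by decide) x).fills_storeMatrix (N := x) ?_
    rintro i hi j hj c hc η' rfl hη'
    refine ⟨by simp [IdxExpr.eval], fun m hm => ?_⟩
    rw [hF _ _ _ _ hi hj hc, outValue, if_pos hx, RealExpr.eval, RealExpr.eval,
      hη'.eval_conjExpr (n' := x) (i' := i) (j' := j) (c' := c) (by
        rintro a b η' rfl
        simp [IdxExpr.eval]) m, conjValue_congr hm (by omega) hi hj hc, Op.eval]
    congr 1
    refine Finset.sum_congr (by rw [IdxExpr.eval, hη'.2.2.2.2]) fun l hl => ?_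
    have hl := Finset.mem_range.1 hl
    rw [(hη'.update (v := 12) (by decide) l).eval_conjExpr (n' := x) (i' := l) (j' := l) (c' := 0)
      (by
        rintro a b η' rfl
        simp [IdxExpr.eval]) m, conjValue_congr hm (by omega) hl hl (by omega)]
  have heffects : effectsStmt.Fills ω m₀ (outAddr X Y Z D d) F (sizeEnv X Y Z D d)
      {a | ∃ y < Y, a ∈ {a | ∃ z < Z - 1, a ∈
        matrixCells (outAddr X Y Z D d) d (X + (y * Z + z))}} := by
    refine Stmt.Fills.loop hη.2.1 fun y hy => ?_
    have hη₁ := hη.update (v := 5) (by decide) y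
    refine Stmt.Fills.loop (N := Z - 1) (by simp only [IdxExpr.eval, hη₁.2.2.1]) fun z hz => ?_
    refine (hη₁.update (v := 6) (by decide) z).fills_storeMatrix (N := X + (y * Z + z)) ?_
    rintro i hi j hj c hc η' rfl hη'
    refine ⟨?_, fun m hm => ?_⟩
    · simp only [effectIdx, IdxExpr.eval, hη'.1, hη'.2.2.1]
      simp
    · rw [hF _ _ _ _ hi hj hc, outValue, if_neg (by omega), Nat.add_sub_cancel_left,
        Nat.mul_add_mod_self_right, Nat.mod_eq_of_lt (by omega), if_pos (by omega), effectExpr,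
        RealExpr.eval, hη'.eval_scaleExpr, hη'.eval_conjExpr (n' := X + (y * Z + z)) (i' := i)
          (j' := j) (c' := c) (by
          rintro a b η'' rfl
          have hη'' := (hη'.update (v := 10) (by decide) a).update (v := 11) (by decide) b
          simp only [effectIdx, IdxExpr.eval, hη''.1, hη''.2.2.1]
          simp) m, conjValue_congr hm (effectIdx_lt hy (by omega)) hi hj hc, hm0 m hm]
      rfl
  have hlast : lastStmt.Fills ω m₀ (outAddr X Y Z D d) F (sizeEnv X Y Z D d)
      {a | ∃ y < Y, a ∈ matrixCells (outAddr X Y Z D d) d (X + (y * Z + (Z - 1)))} := by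
    refine Stmt.Fills.loop hη.2.1 fun y hy => ?_
    have hη₁ := hη.update (v := 5) (by decide) y
    refine hη₁.fills_storeMatrix (N := X + (y * Z + (Z - 1))) ?_
    rintro i hi j hj c hc η' rfl hη'
    refine ⟨?_, fun m hm => ?_⟩
    · simp only [effectIdx, IdxExpr.eval, hη'.1, hη'.2.2.1]
      simp
    · rw [hF _ _ _ _ hi hj hc, outValue, if_neg (by omega), Nat.add_sub_cancel_left,
        Nat.mul_add_mod_self_right, Nat.mod_eq_of_lt (by omega), if_neg (by omega),
        hdiv _ _ (by omega)]
      simp only [RealExpr.eval, Op.eval]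
      refine congrArg₂ (· - ·) ?_ ?_
      · simp [IdxExpr.eval]
      · refine Finset.sum_congr (by simp only [IdxExpr.eval, hη'.2.2.1]) fun z hz => ?_
        have hz := Finset.mem_range.1 hz
        have hη₂ := hη'.update (v := 6) (by decide) z
        rw [effectExpr, RealExpr.eval, hη₂.eval_scaleExpr, hη₂.eval_conjExpr
          (n' := X + (y * Z + z)) (i' := i) (j' := j) (c' := c) (by
          rintro a b η'' rfl
          have hη'' := (hη₂.update (v := 10) (by decide) a).update (v := 11) (by decide) b
          simp only [effectIdx, IdxExpr.eval, hη''.1, hη''.2.2.1]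
          simp) m, conjValue_congr hm (effectIdx_lt hy (by omega)) hi hj hc, hm0 m hm]
        rfl
  intro m hm
  obtain ⟨h1, h2, h3⟩ := (hstates.seq (heffects.seq hlast)) m hm
  refine ⟨h1, ?_, h3⟩
  rintro a ⟨n, hn, i, hi, j, hj, c, hc, rfl⟩
  refine h2 _ ?_
  by_cases hnX : n < X
  · exact Or.inl ⟨n, hnX, i, hi, j, hj, c, hc, rfl⟩
  -- Division with remainder shows that the three statements together cover all blocks.
  · obtain ⟨y, z, hy, hz, rfl⟩ : ∃ y z, y < Y ∧ z < Z ∧ n = X + (y * Z + z) := by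
      refine ⟨(n - X) / Z, (n - X) % Z, (Nat.div_lt_iff_lt_mul hZ).2 (by omega),
        Nat.mod_lt _ hZ, ?_⟩
      have := Nat.div_add_mod' (n - X) Z
      omega
    right
    by_cases hzZ : z < Z - 1
    · exact Or.inl ⟨y, hy, z, hzZ, i, hi, j, hj, c, hc, rfl⟩
    · rw [show z = Z - 1 by omega]
      exact Or.inr ⟨y, hy, i, hi, j, hj, c, hc, rfl⟩

/-! ### The computed numbers are the entries of the compressed model -/

open Matrix

/-- The memory after drawing the Gaussian matrix. -/
def drawnMemory (X Y Z D d : ℕ) (ω m : ℕ → ℝ) (a : ℕ) : ℝ :=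
  if gaussAddr X Y Z D ≤ a ∧ a < gaussAddr X Y Z D + d * D then ω (a - gaussAddr X Y Z D) else m a

theorem drawnMemory_gauss (ω m : ℕ → ℝ) (i : Fin d) (a : Fin D) :
    drawnMemory X Y Z D d ω m (gaussAddr X Y Z D + (i * D + a)) = sampleMatrix d D ω i a := by
  have := mul_add_lt i.2 a.2
  rw [drawnMemory, if_pos (by omega), Nat.add_sub_cancel_left, sampleMatrix]

theorem drawnMemory_of_lt (ω m : ℕ → ℝ) {a : ℕ} (ha : a < gaussAddr X Y Z D) :
    drawnMemory X Y Z D d ω m a = m a :=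
  if_neg (by omega)

theorem complexMatrix_conj_apply (G : Fin d → Fin D → ℝ) (A : Matrix (Fin D) (Fin D) ℂ)
    (i j : Fin d) : (complexMatrix G * A * (complexMatrix G)ᴴ) i j =
      ∑ a, ∑ b, ((G i a * G j b : ℝ) : ℂ) * A a b := by
  rw [Matrix.mul_apply, Finset.sum_comm]
  refine Finset.sum_congr rfl fun b _ => ?_
  rw [Matrix.mul_apply, Finset.sum_mul]
  refine Finset.sum_congr rfl fun a _ => ?_
  simp [complexMatrix]
  ring

/-- The real part for `c = 0`, the imaginary part otherwise. -/
def part (c : ℕ) (z : ℂ) : ℝ := if c = 0 then z.re else z.im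

theorem part_sum {ι : Type*} (s : Finset ι) (f : ι → ℂ) (c : ℕ) :
    part c (∑ i ∈ s, f i) = ∑ i ∈ s, part c (f i) := by
  unfold part; split_ifs <;> simp

theorem part_ofReal_mul (r : ℝ) (z : ℂ) (c : ℕ) : part c (r * z) = r * part c z := by
  unfold part; split_ifs <;> simp

theorem part_sub (z w : ℂ) (c : ℕ) : part c (z - w) = part c z - part c w := by
  unfold part; split_ifs <;> simp

theorem HoldsMatrix.mem_cell {mem : ℕ → ℝ} {base n k : ℕ} {M : Matrix (Fin k) (Fin k) ℂ}
    (h : HoldsMatrix mem base n M) (i j : Fin k) {c : ℕ} (hc : c < 2) :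
    mem (cell base n k i j c) = part c (M i j) := by
  obtain rfl | rfl : c = 0 ∨ c = 1 := by omega
  · exact (h i j).1
  · exact (h i j).2

theorem holdsMatrix_of_mem_cell {mem : ℕ → ℝ} {base n k : ℕ} {M : Matrix (Fin k) (Fin k) ℂ}
    (h : ∀ (i j : Fin k), ∀ c < 2, mem (cell base n k i j c) = part c (M i j)) :
    HoldsMatrix mem base n M :=
  fun i j => ⟨h i j 0 (by omega), h i j 1 (by omega)⟩

/-- Since `G` is real, the same real formula applies to the real and the imaginary parts. -/
theorem conjValue_eq {ω m : ℕ → ℝ} {n : ℕ} {A : Matrix (Fin D) (Fin D) ℂ}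
    (hA : HoldsMatrix m 1 n A) (hn : n < X + Y * Z) (i j : Fin d) {c : ℕ} (hc : c < 2) :
    conjValue X Y Z D (drawnMemory X Y Z D d ω m) n i j c =
      part c ((complexMatrix (sampleMatrix d D ω) * A * (complexMatrix (sampleMatrix d D ω))ᴴ)
        i j) := by
  rw [complexMatrix_conj_apply, part_sum, conjValue, Finset.sum_range]
  refine Finset.sum_congr rfl fun a _ => ?_
  rw [part_sum, Finset.sum_range]
  refine Finset.sum_congr rfl fun b _ => ?_
  rw [drawnMemory_gauss, drawnMemory_gauss, drawnMemory_of_lt _ _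
    (cell_lt hn a.2 b.2 hc), HoldsMatrix.mem_cell hA a b hc, part_ofReal_mul]

theorem outValue_state {ω m : ℕ → ℝ} {x : Fin X} {ρ : Matrix (Fin D) (Fin D) ℂ}
    (hρ : ρ.PosSemidef) (hm : HoldsMatrix m 1 x ρ) (i j : Fin d) {c : ℕ} (hc : c < 2) :
    outValue X Y Z D d (drawnMemory X Y Z D d ω m) x i j c =
      part c (sketchState (sampleMatrix d D ω) ρ i j) := by
  have hn : (x : ℕ) < X + Y * Z := by omega
  rw [outValue, if_pos x.2, conjValue_eq hm hn i j hc, Finset.sum_range,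
    Finset.sum_congr rfl fun l _ => conjValue_eq hm hn l l (by omega), ← part_sum, sketchState]
  set B := complexMatrix (sampleMatrix d D ω) * ρ * (complexMatrix (sampleMatrix d D ω))ᴴ with hB
  have hpos : B.PosSemidef := hρ.mul_mul_conjTranspose_same _
  -- The trace of a positive semidefinite matrix is real, so dividing by its real part is enough. If
  -- it vanishes, both sides follow the convention `0⁻¹ = 0`, so the identity holds for every `ω`.
  have htr : B.trace = ((part 0 (∑ l, B l l) : ℝ) : ℂ) :=
    Complex.ext rfl (Complex.nonneg_iff.1 hpos.trace_nonneg).2.symm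
  rw [htr, Matrix.smul_apply, smul_eq_mul, ← Complex.ofReal_inv, part_ofReal_mul, inv_mul_eq_div]

theorem effectValue_eq {ω m : ℕ → ℝ} {ε : ℝ} {n : ℕ} {E : Matrix (Fin D) (Fin D) ℂ}
    (hε : m 0 = ε) (hm : HoldsMatrix m 1 n E) (hn : n < X + Y * Z) (i j : Fin d) {c : ℕ}
    (hc : c < 2) : effectValue X Y Z D d (drawnMemory X Y Z D d ω m) n i j c =
      part c (sketchEffect (sampleMatrix d D ω) ε E i j) := by
  rw [effectValue, conjValue_eq hm hn i j hc, drawnMemory_of_lt _ _ (by unfold gaussAddr; omega),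
    hε, sketchEffect, Matrix.smul_apply, smul_eq_mul, ← Complex.ofReal_inv, part_ofReal_mul,
    inv_mul_eq_div]

theorem sum_range_pred_eq (hZ : 0 < Z) (f : ℕ → ℝ) : ∑ z ∈ Finset.range (Z - 1), f z =
    ∑ z ∈ Finset.univ.filter (fun z : Fin Z => (z : ℕ) + 1 < Z), f z := by
  obtain ⟨k, rfl⟩ : ∃ k, Z = k + 1 := ⟨Z - 1, by omega⟩
  rw [Finset.sum_filter, Fin.sum_univ_eq_sum_range (fun z => if z + 1 < k + 1 then f z else 0),
    Finset.sum_range_succ, if_neg (by omega), add_zero, Nat.add_sub_cancel]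
  exact Finset.sum_congr rfl fun z hz => by
    rw [if_pos (by have := Finset.mem_range.1 hz; omega)]

/-- With truncated subtraction `(i - j) + (j - i)` is `|i - j|`, so the left side is `1` exactly if
`i = j` and `c = 0`. This yields the identity matrix in a language without branching. -/
theorem cast_one_sub_eq (i j : Fin d) {c : ℕ} (hc : c < 2) :
    ((1 - ((i - j : ℕ) + (j - i : ℕ) + c) : ℕ) : ℝ) =
      part c ((1 : Matrix (Fin d) (Fin d) ℂ) i j) := by
  obtain rfl | rfl : c = 0 ∨ c = 1 := by omega
  · rw [Matrix.one_apply, part, if_pos rfl]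
    split_ifs with h
    · simp [h]
    · have : (i : ℕ) ≠ j := fun h' => h (Fin.ext h')
      rw [show 1 - ((i - j : ℕ) + (j - i : ℕ) + 0) = 0 by omega]
      simp
  · rw [Matrix.one_apply, part, if_neg one_ne_zero]
    rw [show 1 - ((i - j : ℕ) + (j - i : ℕ) + 1) = 0 by omega]
    split_ifs <;> simp

theorem outValue_effect {ω m : ℕ → ℝ} {ε : ℝ} (hZ : 0 < Z)
    {E : Fin Z → Matrix (Fin D) (Fin D) ℂ} {y : Fin Y} (hε : m 0 = ε)
    (hm : ∀ z : Fin Z, HoldsMatrix m 1 (X + (y * Z + z)) (E z)) (z : Fin Z) (i j : Fin d) {c : ℕ}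
    (hc : c < 2) :
    outValue X Y Z D d (drawnMemory X Y Z D d ω m) (X + (y * Z + z)) i j c =
      part c (sketchPOVM (sampleMatrix d D ω) ε E z i j) := by
  have hdiv : ((y * Z + z : ℕ)) / Z = y := by
    rw [add_comm, Nat.add_mul_div_right _ _ hZ, Nat.div_eq_of_lt z.2, zero_add]
  rw [outValue, if_neg (by omega), Nat.add_sub_cancel_left, Nat.mul_add_mod_self_right,
    Nat.mod_eq_of_lt z.2, hdiv, sketchPOVM]
  split_ifs with hz
  · exact effectValue_eq hε (hm z) (effectIdx_lt y.2 z.2) i j hc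
  · rw [Matrix.sub_apply, part_sub, cast_one_sub_eq i j hc, sketchEffect_sumButLast,
      Matrix.sum_apply, part_sum, sum_range_pred_eq hZ
        fun z => effectValue X Y Z D d (drawnMemory X Y Z D d ω m) (X + (y * Z + z)) i j c]
    congr 1
    exact Finset.sum_congr rfl fun z _ => effectValue_eq hε (hm z) (effectIdx_lt y.2 z.2) i j hc

/-- The program that compresses a quantum model by a Gaussian matrix. -/
def sketchProgram : Program := mainProgram scratchExpr outExpr sketchStmt

theorem sketchProgram_spec : ∃ l, ∀ (X Y Z D d : ℕ) (ε : ℝ)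
    (ρ : Fin X → Matrix (Fin D) (Fin D) ℂ) (E : Fin Y → Fin Z → Matrix (Fin D) (Fin D) ℂ)
    (s : State) (ω : ℕ → ℝ), 0 < Z → 0 < D → (∀ x, (ρ x).PosSemidef) → IsInput s d ε ρ E →
    ∃ s', Runs ω sketchProgram s ((X + Y + Z + max D d) ^ l) s' ∧
      IsOutput s' (fun x => sketchState (sampleMatrix d D ω) (ρ x))
        (fun y => sketchPOVM (sampleMatrix d D ω) ε (E y)) := by
  obtain ⟨l, hl⟩ := mainProgram_spec scratchExpr outExpr sketchStmt
  refine ⟨l, fun X Y Z D d ε ρ E s ω hZ hD hρ hs => ?_⟩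
  obtain ⟨h0, h1, h2, h3, h4, hε, ⟨hst, hef⟩, hpos⟩ := hs
  have hη := hasSizes_sizeEnv (X := X) (Y := Y) (Z := Z) (D := D) (d := d)
  obtain ⟨s', hrun, hidx, hmem⟩ := hl X Y Z D d s ω (by omega) h0 h1 h2 h3 h4
    (bounded_sketchStmt hZ)
  refine ⟨s', hrun, ?_⟩
  rw [hη.eval_outExpr] at hidx
  rw [hη.eval_scratchExpr] at hmem
  set m₀ := drawnMemory X Y Z D d ω s.mem with hm₀
  obtain ⟨F, hF⟩ := exists_cell_function (outAddr X Y Z D d) d (outValue X Y Z D d m₀)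
  have hdraw : (drawStmt.run ω (sizeEnv X Y Z D d) (s.mem, s.pos)).1 = m₀ := by
    rw [hpos]
    refine Stmt.run_for_sample (N := d * D) (B := gaussAddr X Y Z D) 12 _
      (by simp [IdxExpr.eval, hη.2.2.2.2, hη.2.2.2.1]) (fun k => ?_) _
    rw [IdxExpr.eval, (hη.update (v := 12) (by decide) k).eval_gaussExpr]
    simp [IdxExpr.eval]
  have hfill := (fills_outputStmt (ω := ω) hZ fun n i j c => hF n i j c)
    (drawStmt.run ω (sizeEnv X Y Z D d) (s.mem, s.pos)) (fun a _ => by rw [hdraw])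
  have hout : ∀ n < X + Y * Z, ∀ i < d, ∀ j < d, ∀ c < 2,
      s'.mem (cell (outAddr X Y Z D d) n d i j c) = outValue X Y Z D d m₀ n i j c := by
    intro n hn i hi j hj c hc
    rw [hmem _ (cell_lt hn hi hj hc), ← hF n i j c hi hj hc]
    exact hfill.2.1 _ ⟨n, hn, i, hi, j, hj, c, hc, rfl⟩
  rw [IsOutput, hidx]
  refine ⟨fun x => holdsMatrix_of_mem_cell fun i j c hc => ?_, fun y z =>
    holdsMatrix_of_mem_cell fun i j c hc => ?_⟩
  · rw [hout _ (by omega) _ i.2 _ j.2 _ hc]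
    exact outValue_state (hρ x) (hst x) i j hc
  · rw [hout _ (effectIdx_lt y.2 z.2) _ i.2 _ j.2 _ hc]
    exact outValue_effect hZ hε (hef y) z i j hc

end Sketch

end RealRAM

/-! ### Conclusion -/

theorem two_thirds_le_gaussians {p : (ℕ → ℝ) → Prop}
    (h : RealRAM.gaussians {ω | ¬ p ω} ≤ ENNReal.ofReal (1 / 3)) :
    2 / 3 ≤ RealRAM.gaussians {ω | p ω} := by
  have hprob : MeasureTheory.IsProbabilityMeasure RealRAM.gaussians := by
    unfold RealRAM.gaussians; infer_instance
  -- Subadditivity, which needs no measurability of the event.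
  have h1 : (1 : ENNReal) ≤ RealRAM.gaussians {ω | p ω} + ENNReal.ofReal (1 / 3) := by
    rw [← hprob.measure_univ, show Set.univ = {ω | p ω} ∪ {ω | ¬ p ω} from
      (Set.union_compl_self {ω | p ω}).symm]
    exact (MeasureTheory.measure_union_le _ _).trans (by gcongr)
  have h2 : (2 / 3 : ENNReal) + ENNReal.ofReal (1 / 3) = 1 := by
    rw [show (2 / 3 : ENNReal) = ENNReal.ofReal (2 / 3) by
      rw [ENNReal.ofReal_div_of_pos (by norm_num)]; simp, ← ENNReal.ofReal_add (by norm_num)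
      (by norm_num)]
    norm_num
  rw [← h2] at h1
  exact (ENNReal.add_le_add_iff_right ENNReal.ofReal_ne_top).1 h1

theorem theorem3 :
    -- one program and one polynomial bound for all inputs
    ∃ (P : RealRAM.Program) (C k : ℕ),
      ∀ (X Y Z D d : ℕ) (ε : ℝ) (ρ : Fin X → Matrix (Fin D) (Fin D) ℂ)
        (E : Fin Y → Fin Z → Matrix (Fin D) (Fin D) ℂ),
        0 < Z → 0 < D → 0 < ε → ε ≤ 1 / 2 →
        IsQuantumModel ρ E →
        32 / ε ^ 2 * Real.log (4 * ((X + Y * Z : ℕ) : ℝ) * (D : ℝ)) < (d : ℝ) →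
        (∀ y, 32 / ε ^ 2 * ((sumButLast (E y)).rank : ℝ) < (d : ℝ)) →
        -- existence of the compressed model
        (∃ (ρ' : Fin X → Matrix (Fin d) (Fin d) ℂ) (E' : Fin Y → Fin Z → Matrix (Fin d) (Fin d) ℂ),
          IsQuantumModel ρ' E' ∧ Approximates ε ρ E ρ' E') ∧
        -- its computation in randomized polynomial time
        ∀ s : RealRAM.State, RealRAM.IsInput s d ε ρ E →
          (∀ ω : ℕ → ℝ, ∃ (t : ℕ) (s' : RealRAM.State), RealRAM.Exec ω P s t s' ∧
            t ≤ C * (X + Y + Z + max D d) ^ k) ∧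
          2 / 3 ≤ RealRAM.gaussians {ω : ℕ → ℝ | ∃ (t : ℕ) (s' : RealRAM.State)
            (ρ' : Fin X → Matrix (Fin d) (Fin d) ℂ)
            (E' : Fin Y → Fin Z → Matrix (Fin d) (Fin d) ℂ),
            RealRAM.Exec ω P s t s' ∧ RealRAM.IsOutput s' ρ' E' ∧
            IsQuantumModel ρ' E' ∧ Approximates ε ρ E ρ' E'} := by
  obtain ⟨l, hl⟩ := RealRAM.Sketch.sketchProgram_spec
  refine ⟨RealRAM.Sketch.sketchProgram, 1, l, ?_⟩
  intro X Y Z D d ε ρ E hZ hD h0 h1 hM hlog hrank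
  have hε2 : 0 < ε ^ 2 := by positivity
  have hscale : ∀ t : ℝ, 32 / ε ^ 2 * t < d → 32 * t ≤ d * ε ^ 2 := fun t ht => by
    rw [div_mul_eq_mul_div, div_lt_iff₀ hε2] at ht
    exact ht.le
  have hd : 0 < d := by
    -- The argument is a natural number, possibly `0`, where the logarithm is `0` by convention.
    have h2 : 0 ≤ Real.log (4 * ((X + Y * Z : ℕ) : ℝ) * (D : ℝ)) := by
      have := Real.log_natCast_nonneg (4 * (X + Y * Z) * D)
      push_cast at this ⊢
      exact this
    have h3 : (0 : ℝ) < d := lt_of_le_of_lt (by positivity) hlog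
    exact_mod_cast h3
  -- The decompositions only define the good event; the program never computes them.
  choose p ψ hρ using fun x => (hM.1 x).1.exists_isMixture
  choose q φ hE using fun y z => ((hM.2 y).1 z).exists_isMixture
  have hprob : 2 / 3 ≤ RealRAM.gaussians {ω | GoodSketch (sampleMatrix d D ω) ε ψ φ
      fun y => sumButLast (E y)} :=
    two_thirds_le_gaussians ((gaussians_sampleMatrix_le fun G => ¬ GoodSketch G ε ψ φ
      fun y => sumButLast (E y)).trans
      (gaussianMatrix_goodSketch hZ hD hd h0 h1 ψ φ _ (hscale _ hlog) fun y => hscale _ (hrank y)))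
  have hgood : ∀ ω, GoodSketch (sampleMatrix d D ω) ε ψ φ (fun y => sumButLast (E y)) → _ :=
    fun ω h => h.isQuantumModel_and_approximates hZ hd h0 h1 hM hρ hE
  refine ⟨?_, fun s hs => ⟨fun ω => ?_, hprob.trans (MeasureTheory.measure_mono ?_)⟩⟩
  -- Probabilistic method: the good event has positive probability, so it is not empty.
  · obtain ⟨ω, hω⟩ := MeasureTheory.nonempty_of_measure_ne_zero
      (ne_of_gt (lt_of_lt_of_le (by simp) hprob))
    exact ⟨_, _, hgood ω hω⟩
  · obtain ⟨s', ⟨t, ht, hex⟩, -⟩ := hl X Y Z D d ε ρ E s ω hZ hD (fun x => (hM.1 x).1) hs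
    exact ⟨t, s', hex, by rwa [one_mul]⟩
  · intro ω hω
    obtain ⟨s', ⟨t, ht, hex⟩, hout⟩ := hl X Y Z D d ε ρ E s ω hZ hD (fun x => (hM.1 x).1) hs
    exact ⟨t, s', _, _, hex, hout, hgood ω hω⟩
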